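/- Let $\mathbf k$ be a field of characteristic $0$, $A$ a finite-dimensional vector space, $(A,\circ,[\cdot,\cdot])$ a Gel'fand–Dorfman (GD) algebra and $(A,\Delta,\delta_0)$ a GD coalgebra, and let $\circ_{A^*}=\Delta^*$, $[\cdot,\cdot]_{A^*}=\delta_0^*$ be the dual GD algebra structure on $A^*$. **Conventions.** A GD algebra is a Novikov algebra $(A,\circ)$ with a Lie bracket satisfying $[a\circ b,c]-[a\circ c,b]+[a,b]\circ c-[a,c]\circ b-a\circ[b,c]=0$; GD coalgebras are the dual notion. Put $a\star b=a\circ b+b\circ a$, $L_\circ(a)b=a\circ b$, $R_\circ(a)b=b\circ a$, let $\tau$ be the flip, and for $\varphi:A\to\mathrm{End}(V)$ let $\langle\varphi^*(a)f,v\rangle=-\langle f,\varphi(a)v\rangle$. The quintuple $(A,\circ,[\cdot,\cdot],\Delta,\delta_0)$ is a *GD bialgebra* if $(A,\circ,\Delta)$ is a Novikov bialgebra, i.e. for all $a,b\in A$ $$\Delta(a\circ b)=(R_\circ(b)\otimes\mathrm{id})\Delta(a)+(\mathrm{id}\otimes L_\star(a))(\Delta(b)+\tau\Delta(b)),$$ $$(L_\star(a)\otimes\mathrm{id})\Delta(b)-(\mathrm{id}\otimes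 L_\star(a))\tau\Delta(b)=(L_\star(b)\otimes\mathrm{id})\Delta(a)-(\mathrm{id}\otimes L_\star(b))\tau\Delta(a),$$ $$(\mathrm{id}\otimes R_\circ(a)-R_\circ(a)\otimes\mathrm{id})(\Delta(b)+\tau\Delta(b))=(\mathrm{id}\otimes R_\circ(b)-R_\circ(b)\otimes\mathrm{id})(\Delta(a)+\tau\Delta(a)),$$ $(A,[\cdot,\cdot],\delta_0)$ is a Lie bialgebra, and $$\delta_0(b\circ a)+\Delta([a,b])=(R_\circ(a)\otimes\mathrm{id})\delta_0(b)+(L_\circ(b)\otimes\mathrm{id})\delta_0(a)+(\mathrm{id}\otimes L_\star(b))\delta_0(a)+(\mathrm{ad}(a)\otimes\mathrm{id}+\mathrm{id}\otimes\mathrm{ad}(a))\Delta(b)-(\mathrm{id}\otimes\mathrm{ad}(b))(\Delta(a)+\tau\Delta(a)).$$ Let $R=\mathbf k[\partial]A$ be the Lie conformal algebra with $[a_\lambda b]=\partial(b\circ a)+\lambda(a\star b)+[a,b]$ for $a,b\in A$, and let $\delta:R\to R\otimes R$ be the $\mathbf k[\partial]$-homomorphism with $\delta(a)=\delta_0(a)+(\partial\otimes\mathrm{id})\Delta(a)-\tau(\partial\otimes\mathrm{id})\Delta(a)$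 for $a\in A$. Let $R^{*c}$ be the conformal dual, the $\mathbf k$-linear maps $f:R\to\mathbf k[\lambda]$ with $f_\lambda(\partial u)=\lambda f_\lambda(u)$ and $(\partial f)_\lambda=-\lambda f_\lambda$. It is identified with $\mathbf k[\partial]A^*$ by $f_\lambda(a)=\langle f,a\rangle$ ($f\in A^*$, $a\in A$), and carries the Lie conformal algebra structure corresponding to the GD algebra $A^*$; $R$ is identified with $(R^{*c})^{*c}$ by $a\mapsto(f\mapsto f_{-\lambda}(a))$. The coadjoint map $\mathrm{ad}_R^*$ is given by $(\mathrm{ad}_R^*(a)_\lambda f)_\mu u=-f_{\mu-\lambda}([a_\lambda u])$, and similarly for $\mathrm{ad}_{R^{*c}}^*$. Let $\langle\cdot,\cdot\rangle_\lambda$ be the conformal bilinear form on $\mathbf k[\partial](A\oplus A^*)$ with $\langle a+f,b+g\rangle_\lambda=\langle f,b\rangle+\langle g,a\rangle$ for $a,b\in A$, $f,g\in A^*$. **Proposition.** (1) The following are equivalent: (a) $(A,\circ,[\cdot,\cdot],\Delta,\delta_0)$ is a GD bialgebra; (b) there is a GD algebra structure on $A\oplus A^*$ making $(A\oplus A^*,A,A^*)$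 a (standard) Manin triple of GD algebras; (c) $(A,A^*,L_\star^*,-R_\circ^*,\mathrm{ad}^*,L_{\star_{A^*}}^*,-R_{\circ_{A^*}}^*,\mathrm{ad}_{A^*}^*)$ is a matched pair of GD algebras; (d) $(R,[\cdot_\lambda\cdot],\delta)$ is a Lie conformal bialgebra; (e) there is a Lie conformal algebra structure on $\mathbf k[\partial](A\oplus A^*)$ making $(\mathbf k[\partial](A\oplus A^*),\mathbf k[\partial]A,\mathbf k[\partial]A^*)$ with the form $\langle\cdot,\cdot\rangle_\lambda$ a conformal Manin triple; (f) $(R,R^{*c},\mathrm{ad}_R^*,\mathrm{ad}_{R^{*c}}^*)$ is a matched pair of Lie conformal algebras. (2) Let $(A,\circ,[\cdot,\cdot],\Delta,\delta_0)$ be a GD bialgebra, and give $A\oplus A^*$ the operations of the matched pair in (c). This is a Manin triple of GD algebras, and the Lie conformal algebra $\mathbf k[\partial](A\oplus A^*)$ corresponding to it, with $\langle\cdot,\cdot\rangle_\lambda$, is a conformal Manin triple with subalgebras $\mathbf k[\partial]A$ and $\mathbf k[\partial]A^*$. The Lie conformal bialgebra obtained from this triple is $(R,[\cdot_\lambda\cdot],\delta)$: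 the bracket of $R$ is the only one that is the restriction of the bracket of the triple, and $\delta$ is the only linear map $\bar\delta:R\to R\otimes R$ such that $$\langle[f_\mu g],a\rangle_\lambda=\sum\langle f,a_{(1)}\rangle_\mu\,\langle g,a_{(2)}\rangle_{\lambda-\mu},\qquad \bar\delta(a)=\sum a_{(1)}\otimes a_{(2)},$$ for all $a\in R$ and $f,g\in\mathbf k[\partial]A^*$. The Lie conformal bialgebra obtained in the same way from the matched pair $(R,R^{*c},\mathrm{ad}_R^*,\mathrm{ad}_{R^{*c}}^*)$, i.e. with cobracket determined by $[f_\mu g]_\lambda(a)=\sum f_\mu(a_{(1)})g_{\lambda-\mu}(a_{(2)})$ for $f,g\in R^{*c}$, is $(R,[\cdot_\lambda\cdot],\delta)$ as well. Moreover the canonical map $\mathbf k[\partial](A\oplus A^*)\to R\oplus R^{*c}$ is an isomorphism from the Lie conformal algebra of the Manin triple onto that of the matched pair, and it carries $\langle\cdot,\cdot\rangle_\lambda$ to the form $f_\lambda(b)+g_{-\lambda}(a)$ of $a+f$ and $b+g$. -/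

import Mathlib

set_option maxSynthPendingDepth 3

open Polynomial TensorProduct

namespace GDConformal

noncomputable section

/-! ## Gel'fand-Dorfman algebras -/

section Algebras

variable {k : Type*} [Field k] {A : Type*} [AddCommGroup A] [Module k A]

/-- Novikov algebras: left-symmetric, with commuting right multiplications. -/
structure IsNovikov (m : A →ₗ[k] A →ₗ[k] A) : Prop where
  left_symm : ∀ a b c, m (m a b) c - m a (m b c) = m (m b a) c - m b (m a c)
  right_comm : ∀ a b c, m (m a b) c = m (m a c) b

/-- Lie algebra structures on a given vector space. -/
structure IsLie (br : A →ₗ[k] A →ₗ[k] A) : Prop where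
  alternating : ∀ a, br a a = 0
  jacobi : ∀ a b c, br a (br b c) = br (br a b) c + br b (br a c)

/-- Gel'fand-Dorfman (GD) algebras. -/
structure IsGDAlgebra (m br : A →ₗ[k] A →ₗ[k] A) : Prop where
  novikov : IsNovikov m
  lie : IsLie br
  compat : ∀ a b c,
    br (m a b) c - br (m a c) b + m (br a b) c - m (br a c) b - m a (br b c) = 0

/-- `a ⋆ b = a ∘ b + b ∘ a`. -/
def starOp (m : A →ₗ[k] A →ₗ[k] A) : A →ₗ[k] A →ₗ[k] A := m + m.flip

/-! ## Coalgebras.  All threefold tensors are taken in `A ⊗ (A ⊗ A)`. -/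

/-- `id ⊗ D`. -/
def idT (D : A →ₗ[k] A ⊗[k] A) : A ⊗[k] A →ₗ[k] A ⊗[k] (A ⊗[k] A) :=
  TensorProduct.map LinearMap.id D

/-- `D ⊗ id`. -/
def tId (D : A →ₗ[k] A ⊗[k] A) : A ⊗[k] A →ₗ[k] A ⊗[k] (A ⊗[k] A) :=
  (TensorProduct.assoc k A A A).toLinearMap ∘ₗ TensorProduct.map D LinearMap.id

/-- The flip `τ` of `A ⊗ A`. -/
def tau : A ⊗[k] A →ₗ[k] A ⊗[k] A := (TensorProduct.comm k A A).toLinearMap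

/-- `τ ⊗ id`, that is `a ⊗ b ⊗ c ↦ b ⊗ a ⊗ c`. -/
def tau12 : A ⊗[k] (A ⊗[k] A) →ₗ[k] A ⊗[k] (A ⊗[k] A) :=
  (TensorProduct.leftComm k A A A).toLinearMap

/-- Novikov coalgebras. -/
structure IsNovikovCoalgebra (D : A →ₗ[k] A ⊗[k] A) : Prop where
  left_symm : ∀ a, idT D (D a) - tau12 (idT D (D a)) = tId D (D a) - tau12 (tId D (D a))
  right_comm : ∀ a, tau12 (idT D (tau (D a))) = tId D (D a)

/-- Lie coalgebras. -/
structure IsLieCoalgebra (d : A →ₗ[k] A ⊗[k] A) : Prop where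
  skew : ∀ a, d a = - tau (d a)
  jacobi : ∀ a, idT d (d a) - tau12 (idT d (d a)) = tId d (d a)

/-- GD coalgebras `(A, Δ, δ)`. -/
structure IsGDCoalgebra (D d : A →ₗ[k] A ⊗[k] A) : Prop where
  novikov : IsNovikovCoalgebra D
  lie : IsLieCoalgebra d
  compat : ∀ a, idT d (D a) - tau12 (idT D (d a)) + tau12 (idT d (tau (D a)))
    = tId D (d a) + tId d (D a)

/-! ## Bialgebras -/

/-- `f ⊗ id` for `f ∈ End A`. -/
def onL (f : A →ₗ[k] A) : A ⊗[k] A →ₗ[k] A ⊗[k] A := TensorProduct.map f LinearMap.id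

/-- `id ⊗ f` for `f ∈ End A`. -/
def onR (f : A →ₗ[k] A) : A ⊗[k] A →ₗ[k] A ⊗[k] A := TensorProduct.map LinearMap.id f

/-- Novikov bialgebras.  Here `m a` is `L_∘(a)`, `m.flip a` is `R_∘(a)`, `starOp m a` is `L_⋆(a)`. -/
structure IsNovikovBialgebra (m : A →ₗ[k] A →ₗ[k] A) (D : A →ₗ[k] A ⊗[k] A) : Prop where
  algebra : IsNovikov m
  coalgebra : IsNovikovCoalgebra D
  compat₁ : ∀ a b, D (m a b) = onL (m.flip b) (D a) + onR (starOp m a) (D b + tau (D b))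
  compat₂ : ∀ a b, onL (starOp m a) (D b) - onR (starOp m a) (tau (D b))
    = onL (starOp m b) (D a) - onR (starOp m b) (tau (D a))
  compat₃ : ∀ a b,
    onR (m.flip a) (D b + tau (D b)) - onL (m.flip a) (D b + tau (D b))
      = onR (m.flip b) (D a + tau (D a)) - onL (m.flip b) (D a + tau (D a))

/-- Lie bialgebras. -/
structure IsLieBialgebra (br : A →ₗ[k] A →ₗ[k] A) (d : A →ₗ[k] A ⊗[k] A) : Prop where
  algebra : IsLie br
  coalgebra : IsLieCoalgebra d
  cocycle : ∀ a b, d (br a b)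
    = (onL (br a) (d b) + onR (br a) (d b)) - (onL (br b) (d a) + onR (br b) (d a))

/-- GD bialgebras `(A, ∘, [·,·], Δ, δ)`: a GD algebra and a GD coalgebra for which `(A, ∘, Δ)` is a
Novikov bialgebra, `(A, [·,·], δ)` is a Lie bialgebra, and one mixed compatibility holds. -/
structure IsGDBialgebra (m br : A →ₗ[k] A →ₗ[k] A) (D d : A →ₗ[k] A ⊗[k] A) : Prop where
  algebra : IsGDAlgebra m br
  coalgebra : IsGDCoalgebra D d
  novikov : IsNovikovBialgebra m D
  lie : IsLieBialgebra br d
  compat : ∀ a b, d (m b a) + D (br a b)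
    = onL (m.flip a) (d b) + onL (m b) (d a) + onR (starOp m b) (d a)
      + (onL (br a) (D b) + onR (br a) (D b)) - onR (br b) (D a + tau (D a))

/-- The product on the dual space given by a coproduct: `⟨f ∘ g, a⟩ = ⟨f ⊗ g, Δ(a)⟩`. -/
def dualOp (D : A →ₗ[k] A ⊗[k] A) :
    Module.Dual k A →ₗ[k] Module.Dual k A →ₗ[k] Module.Dual k A :=
  LinearMap.mk₂ k (fun f g => TensorProduct.dualDistrib k A A (f ⊗ₜ[k] g) ∘ₗ D)
    (fun f f' g => by rw [add_tmul, map_add, LinearMap.add_comp])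
    (fun c f g => by rw [← smul_tmul', map_smul, LinearMap.smul_comp])
    (fun f g g' => by rw [tmul_add, map_add, LinearMap.add_comp])
    (fun c f g => by rw [tmul_smul, map_smul, LinearMap.smul_comp])

/-! ## Matched pairs and Manin triples of GD algebras -/

variable {B : Type*} [AddCommGroup B] [Module k B]

/-- `(a+x) • (b+y) = (a∘b + l_B(x)b + r_B(y)a) + (x∘y + l_A(a)y + r_A(b)x)` on `A ⊕ B`. -/
def matchMul (mA : A →ₗ[k] A →ₗ[k] A) (mB : B →ₗ[k] B →ₗ[k] B)
    (lA rA : A →ₗ[k] B →ₗ[k] B) (lB rB : B →ₗ[k] A →ₗ[k] A) :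
    (A × B) →ₗ[k] (A × B) →ₗ[k] (A × B) :=
  LinearMap.mk₂ k
    (fun u v => (mA u.1 v.1 + lB u.2 v.1 + rB v.2 u.1, mB u.2 v.2 + lA u.1 v.2 + rA v.1 u.2))
    (fun u u' v => by ext <;> simp <;> abel)
    (fun c u v => by ext <;> simp)
    (fun u v v' => by ext <;> simp <;> abel)
    (fun c u v => by ext <;> simp)

/-- `[a+x, b+y] = ([a,b] + ρ_B(x)b - ρ_B(y)a) + ([x,y] + ρ_A(a)y - ρ_A(b)x)` on `A ⊕ B`. -/
def matchBr (brA : A →ₗ[k] A →ₗ[k] A) (brB : B →ₗ[k] B →ₗ[k] B)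
    (rhoA : A →ₗ[k] B →ₗ[k] B) (rhoB : B →ₗ[k] A →ₗ[k] A) :
    (A × B) →ₗ[k] (A × B) →ₗ[k] (A × B) :=
  LinearMap.mk₂ k
    (fun u v => (brA u.1 v.1 + rhoB u.2 v.1 - rhoB v.2 u.1,
      brB u.2 v.2 + rhoA u.1 v.2 - rhoA v.1 u.2))
    (fun u u' v => by ext <;> simp <;> abel)
    (fun c u v => by ext <;> simp [smul_add, smul_sub])
    (fun u v v' => by ext <;> simp <;> abel)
    (fun c u v => by ext <;> simp [smul_add, smul_sub])

/-- Matched pairs of GD algebras `(A, B, l_A, r_A, ρ_A, l_B, r_B, ρ_B)`. -/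
structure IsMatchedPairGD (mA brA : A →ₗ[k] A →ₗ[k] A) (mB brB : B →ₗ[k] B →ₗ[k] B)
    (lA rA rhoA : A →ₗ[k] B →ₗ[k] B) (lB rB rhoB : B →ₗ[k] A →ₗ[k] A) : Prop where
  left : IsGDAlgebra mA brA
  right : IsGDAlgebra mB brB
  total : IsGDAlgebra (matchMul mA mB lA rA lB rB) (matchBr brA brB rhoA rhoB)

/-- For `φ : A → End V`, the map `φ* : A → End V*` with `⟨φ*(a)f, u⟩ = -⟨f, φ(a)u⟩`. -/
def dualRep {V : Type*} [AddCommGroup V] [Module k V] (phi : A →ₗ[k] V →ₗ[k] V) :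
    A →ₗ[k] Module.Dual k V →ₗ[k] Module.Dual k V :=
  LinearMap.mk₂ k (fun a f => - (f ∘ₗ phi a))
    (fun a a' f => by ext; simp; abel)
    (fun c a f => by ext; simp)
    (fun a f f' => by ext; simp; abel)
    (fun c a f => by ext; simp)

/-- For `φ : A* → End A*`, the map `φ* : A* → End A** = End A`. -/
def dualRep' [FiniteDimensional k A]
    (phi : Module.Dual k A →ₗ[k] Module.Dual k A →ₗ[k] Module.Dual k A) :
    Module.Dual k A →ₗ[k] A →ₗ[k] A :=
  LinearMap.mk₂ k (fun f a =>
      (Module.evalEquiv k A).symm (dualRep phi f (Module.evalEquiv k A a)))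
    (fun f f' a => by simp) (fun c f a => by simp) (fun f a a' => by simp) (fun c f a => by simp)

/-- The product on `A ⊕ A*` with `l_A = L_⋆^*`, `r_A = -R_∘^*`, and the same for `A*`. -/
def doubleMul [FiniteDimensional k A] (m : A →ₗ[k] A →ₗ[k] A)
    (m' : Module.Dual k A →ₗ[k] Module.Dual k A →ₗ[k] Module.Dual k A) :
    (A × Module.Dual k A) →ₗ[k] (A × Module.Dual k A) →ₗ[k] (A × Module.Dual k A) :=
  matchMul m m' (dualRep (starOp m)) (- dualRep m.flip) (dualRep' (starOp m')) (- dualRep' m'.flip)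

/-- The bracket on `A ⊕ A*` with `ρ_A = ad^*`, and the same for `A*`. -/
def doubleBr [FiniteDimensional k A] (br : A →ₗ[k] A →ₗ[k] A)
    (br' : Module.Dual k A →ₗ[k] Module.Dual k A →ₗ[k] Module.Dual k A) :
    (A × Module.Dual k A) →ₗ[k] (A × Module.Dual k A) →ₗ[k] (A × Module.Dual k A) :=
  matchBr br br' (dualRep br) (dualRep' br')

variable (k A) in
/-- The form `(a+f, b+g) = ⟨f, b⟩ + ⟨g, a⟩` on `A ⊕ A*`. -/
def doubleForm : (A × Module.Dual k A) →ₗ[k] (A × Module.Dual k A) →ₗ[k] k :=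
  LinearMap.mk₂ k (fun u v => u.2 v.1 + v.2 u.1)
    (fun u u' v => by simp; abel) (fun c u v => by simp [mul_add])
    (fun u v v' => by simp; abel) (fun c u v => by simp [mul_add])

/-- Quadratic GD algebras. -/
structure IsQuadraticGD (m br : A →ₗ[k] A →ₗ[k] A) (F : A →ₗ[k] A →ₗ[k] k) : Prop where
  algebra : IsGDAlgebra m br
  nondegenerate : F.Nondegenerate
  symm : ∀ a b, F a b = F b a
  invariant_mul : ∀ a b c, F (m a b) c = - F b (starOp m a c)
  invariant_br : ∀ a b c, F (br a b) c = F a (br b c)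

/-- (Standard) Manin triples of GD algebras `(A ⊕ A*, A, A*)`. -/
structure IsManinTripleGD
    (m br : (A × Module.Dual k A) →ₗ[k] (A × Module.Dual k A) →ₗ[k] (A × Module.Dual k A))
    (mA brA : A →ₗ[k] A →ₗ[k] A)
    (mA' brA' : Module.Dual k A →ₗ[k] Module.Dual k A →ₗ[k] Module.Dual k A) : Prop where
  left : IsGDAlgebra mA brA
  right : IsGDAlgebra mA' brA'
  mul_left : ∀ a b, m (a, 0) (b, 0) = (mA a b, 0)
  br_left : ∀ a b, br (a, 0) (b, 0) = (brA a b, 0)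
  mul_right : ∀ f g, m (0, f) (0, g) = (0, mA' f g)
  br_right : ∀ f g, br (0, f) (0, g) = (0, brA' f g)
  quadratic : IsQuadraticGD m br (doubleForm k A)

end Algebras

/-! ## Lie conformal algebras

A `k[∂]`-module is a vector space with a compatible `k[X]`-module structure, `X` acting as `∂`.
An element of `M[λ]` is the finitely supported family of its coefficients.  The base field has
characteristic `0`, so it is infinite, and an identity between polynomials in `λ`, `μ` holds
formally if and only if it holds for all values `l`, `n` of `λ`, `μ` in `k`; identities in
`λ`, `μ` are written in the latter form. -/

section Conformal

/-- `M[λ]`. -/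
abbrev LamPoly (M : Type*) [Zero M] := ℕ →₀ M

variable {k : Type*} [Field k]

/-- Substitution of an operator `T` for `λ`: `∑ λⁿ vₙ ↦ ∑ Tⁿ vₙ`. -/
def subst {M : Type*} [AddCommGroup M] [Module k M] (T : Module.End k M) :
    LamPoly M →ₗ[k] M :=
  Finsupp.lsum k (fun n => (T ^ n : Module.End k M))

/-- The value of a polynomial in `λ` at a scalar `l`. -/
def ev {M : Type*} [AddCommGroup M] [Module k M] (l : k) : LamPoly M →ₗ[k] M :=
  subst (l • (1 : Module.End k M))

/-- A linear map applied to the coefficients. -/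
def mapLam {M N : Type*} [AddCommGroup M] [Module k M] [AddCommGroup N] [Module k N]
    (f : M →ₗ[k] N) : LamPoly M →ₗ[k] LamPoly N := Finsupp.mapRange.linearMap f

variable (k) in
/-- The operator `∂`. -/
def del (M : Type*) [AddCommGroup M] [Module k M] [Module k[X] M] [IsScalarTower k k[X] M] :
    Module.End k M := Algebra.lsmul k k M (X : k[X])

variable (k) in
/-- `∂ ⊗ id + id ⊗ ∂` on `M ⊗ M`. -/
def del2 (M : Type*) [AddCommGroup M] [Module k M] [Module k[X] M] [IsScalarTower k k[X] M] :
    Module.End k (M ⊗[k] M) := onL (del k M) + onR (del k M)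

variable {R : Type*} [AddCommGroup R] [Module k R] [Module k[X] R] [IsScalarTower k k[X] R]
variable {S : Type*} [AddCommGroup S] [Module k S] [Module k[X] S] [IsScalarTower k k[X] S]
variable {P : Type*} [AddCommGroup P] [Module k P] [Module k[X] P] [IsScalarTower k k[X] P]

/-- `k[∂]`-linear maps `ρ : S → Chom(R, R)`, that is `ρ(∂a)_λ = -λ ρ(a)_λ` and
`ρ(a)_λ (∂ v) = (λ + ∂) ρ(a)_λ v`. -/
structure IsConformalAction (rho : S →ₗ[k] R →ₗ[k] LamPoly R) : Prop where
  map_del : ∀ a v (l : k), ev l (rho (del k S a) v) = - (l • ev l (rho a v))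
  conformal : ∀ a v (l : k),
    ev l (rho a (del k R v)) = l • ev l (rho a v) + del k R (ev l (rho a v))

/-- Lie conformal algebras. -/
structure IsLieConformal (br : R →ₗ[k] R →ₗ[k] LamPoly R) : Prop where
  sesquilinear : IsConformalAction br
  skew : ∀ a b (l : k), ev l (br a b) = - subst (-(l • 1) - del k R) (br b a)
  jacobi : ∀ a b c (l n : k),
    ev l (br a (ev n (br b c)))
      = ev (l + n) (br (ev l (br a b)) c) + ev n (br b (ev l (br a c)))

/-- Lie conformal coalgebras. -/
structure IsLieConformalCoalgebra (d : R →ₗ[k] R ⊗[k] R) : Prop where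
  map_del : ∀ a, d (del k R a) = del2 k R (d a)
  lieCoalgebra : IsLieCoalgebra d

/-- `a_λ (x ⊗ y) = [a_λ x] ⊗ y + x ⊗ [a_λ y]`. -/
def tensorAct (br : R →ₗ[k] R →ₗ[k] LamPoly R) (a : R) :
    R ⊗[k] R →ₗ[k] LamPoly (R ⊗[k] R) :=
  TensorProduct.lift (LinearMap.mk₂ k
    (fun x y => mapLam ((TensorProduct.mk k R R).flip y) (br a x)
      + mapLam (TensorProduct.mk k R R x) (br a y))
    (fun x x' y => by ext; simp [mapLam]; abel)
    (fun c x y => by ext; simp [mapLam, smul_tmul'])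
    (fun x y y' => by ext; simp [mapLam, tmul_add]; abel)
    (fun c x y => by ext; simp [mapLam]))

/-- Lie conformal bialgebras. -/
structure IsLieConformalBialgebra (br : R →ₗ[k] R →ₗ[k] LamPoly R) (d : R →ₗ[k] R ⊗[k] R) :
    Prop where
  algebra : IsLieConformal br
  coalgebra : IsLieConformalCoalgebra d
  cocycle : ∀ a b (l : k),
    ev l (tensorAct br a (d b)) - subst (-(l • 1) - del2 k R) (tensorAct br b (d a))
      = d (ev l (br a b))

/-! ## Conformal duals -/

variable (k) in
/-- The conformal dual `M^{*c}`: the `k`-linear maps `f : M → k[λ]` with `f_λ(∂u) = λ f_λ(u)`,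
that is, the `k[X]`-linear maps from `M` to `k[X]`, with the `k[∂]`-action `(∂f)_λ = -λ f_λ`. -/
def ConfDual (M : Type*) [AddCommGroup M] [Module k[X] M] := M →ₗ[k[X]] k[X]

instance (M : Type*) [AddCommGroup M] [Module k[X] M] : AddCommGroup (ConfDual k M) :=
  inferInstanceAs (AddCommGroup (M →ₗ[k[X]] k[X]))

instance (M : Type*) [AddCommGroup M] [Module k[X] M] : Module k (ConfDual k M) :=
  inferInstanceAs (Module k (M →ₗ[k[X]] k[X]))

variable (k) in
/-- The ring homomorphism `p(∂) ↦ p(-λ)`. -/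
def twist : k[X] →ₐ[k] k[X] := Polynomial.aeval (-X)

instance (M : Type*) [AddCommGroup M] [Module k[X] M] : Module k[X] (ConfDual k M) :=
  Module.compHom (M →ₗ[k[X]] k[X]) (twist k).toRingHom

/-- The polynomial `f_λ(u)`. -/
def ConfDual.app {M : Type*} [AddCommGroup M] [Module k[X] M] (f : ConfDual k M) :
    M →ₗ[k[X]] k[X] := f

theorem ConfDual.ext {M : Type*} [AddCommGroup M] [Module k[X] M] {f g : ConfDual k M}
    (h : ∀ u, f.app u = g.app u) : f = g := LinearMap.ext h

@[simp] theorem ConfDual.app_add {M : Type*} [AddCommGroup M] [Module k[X] M]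
    (f g : ConfDual k M) (u : M) : (f + g).app u = f.app u + g.app u := rfl

@[simp] theorem ConfDual.app_smul {M : Type*} [AddCommGroup M] [Module k[X] M]
    (c : k) (f : ConfDual k M) (u : M) : (c • f).app u = c • f.app u := rfl

@[simp] theorem ConfDual.app_psmul {M : Type*} [AddCommGroup M] [Module k[X] M]
    (p : k[X]) (f : ConfDual k M) (u : M) : (p • f).app u = twist k p * f.app u := rfl

instance (M : Type*) [AddCommGroup M] [Module k[X] M] : IsScalarTower k k[X] (ConfDual k M) :=
  ⟨fun c p f => ConfDual.ext fun u => by simp⟩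

theorem twist_twist (p : k[X]) : twist k (twist k p) = p := by
  have h : (twist k).comp (twist k) = AlgHom.id k k[X] := by ext; simp [twist]
  exact DFunLike.congr_fun h p

/-- The number `f_l(u)`, for a value `l` of `λ`. -/
def ConfDual.at {M : Type*} [AddCommGroup M] [Module k M] [Module k[X] M]
    [IsScalarTower k k[X] M] (f : ConfDual k M) (l : k) : M →ₗ[k] k :=
  Polynomial.leval l ∘ₗ f.app.restrictScalars k

variable (k) in
/-- The canonical map `M → (M^{*c})^{*c}`, `a ↦ (f ↦ f_{-λ}(a))`. -/
def bidual (M : Type*) [AddCommGroup M] [Module k[X] M] :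
    M →ₗ[k[X]] ConfDual k (ConfDual k M) where
  toFun a := show ConfDual k M →ₗ[k[X]] k[X] from
    { toFun := fun f => twist k (f.app a)
      map_add' := fun f g => by simp
      map_smul' := fun p f => by simp [twist_twist] }
  map_add' a b := ConfDual.ext fun f =>
    show twist k (f.app (a + b)) = twist k (f.app a) + twist k (f.app b) by simp
  map_smul' p a := ConfDual.ext fun f =>
    show twist k (f.app (p • a)) = twist k p * twist k (f.app a) by simp

/-- `ρ' : S → gc(N)` is the dual of `ρ : S → gc(M)`, where `N` is identified with `M^{*c}` through
`j`: `(ρ'(a)_λ φ)_μ u = -φ_{μ-λ}(ρ(a)_λ u)`.  This determines `ρ'` if `j` is injective. -/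
def IsDualAction (rho : S →ₗ[k] R →ₗ[k] LamPoly R) (j : P →ₗ[k[X]] ConfDual k R)
    (rho' : S →ₗ[k] P →ₗ[k] LamPoly P) : Prop :=
  ∀ a phi u (l n : k),
    (j (ev l (rho' a phi))).at n u = - (j phi).at (n - l) (ev l (rho a u))

/-! ## Matched pairs of Lie conformal algebras -/

/-- The bracket on `R ⊕ S` given by `ρ : R → gc(S)` and `σ : S → gc(R)`:
`[(a+x)_λ (b+y)] = ([a_λ b] + σ(x)_λ b - σ(y)_{-λ-∂} a) + ([x_λ y] + ρ(a)_λ y - ρ(b)_{-λ-∂} x)`. -/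
def IsMatchedBracket (brR : R →ₗ[k] R →ₗ[k] LamPoly R) (brS : S →ₗ[k] S →ₗ[k] LamPoly S)
    (rho : R →ₗ[k] S →ₗ[k] LamPoly S) (sigma : S →ₗ[k] R →ₗ[k] LamPoly R)
    (br : (R × S) →ₗ[k] (R × S) →ₗ[k] LamPoly (R × S)) : Prop :=
  ∀ a b x y (l : k), ev l (br (a, x) (b, y)) =
    (ev l (brR a b) + ev l (sigma x b) - subst (-(l • 1) - del k R) (sigma y a),
      ev l (brS x y) + ev l (rho a y) - subst (-(l • 1) - del k S) (rho b x))

/-- Matched pairs of Lie conformal algebras. -/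
structure IsMatchedPairLCA (brR : R →ₗ[k] R →ₗ[k] LamPoly R) (brS : S →ₗ[k] S →ₗ[k] LamPoly S)
    (rho : R →ₗ[k] S →ₗ[k] LamPoly S) (sigma : S →ₗ[k] R →ₗ[k] LamPoly R) : Prop where
  left : IsLieConformal brR
  right : IsLieConformal brS
  action_left : IsConformalAction rho
  action_right : IsConformalAction sigma
  total : ∃ br, IsMatchedBracket brR brS rho sigma br ∧ IsLieConformal br

/-! ## Conformal Manin triples -/

/-- Nondegenerate invariant symmetric conformal bilinear forms on `(P, br)`.  Nondegeneracy says
that `v ↦ ⟨v, ·⟩` is a bijection from `P` onto its conformal dual. -/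
structure IsInvariantConformalForm (br : P →ₗ[k] P →ₗ[k] LamPoly P)
    (F : P →ₗ[k] P →ₗ[k] k[X]) : Prop where
  del_left : ∀ u v, F (del k P u) v = - (X * F u v)
  del_right : ∀ u v, F u (del k P v) = X * F u v
  symm : ∀ u v (l : k), (F u v).eval l = (F v u).eval (-l)
  invariant : ∀ a b c (l n : k),
    (F (ev n (br a b)) c).eval l = (F a (subst (l • 1 - del k P) (br b c))).eval n
  nondegenerate : ∀ phi : ConfDual k P, ∃! v, ∀ u, F v u = phi.app u

/-- Conformal Manin triples `(P, R, S)` of finite Lie conformal algebras; `R` and `S` are the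
subalgebras given by the injections `i` and `j`. -/
structure IsConformalManinTriple (br : P →ₗ[k] P →ₗ[k] LamPoly P) (F : P →ₗ[k] P →ₗ[k] k[X])
    (brR : R →ₗ[k] R →ₗ[k] LamPoly R) (i : R →ₗ[k[X]] P)
    (brS : S →ₗ[k] S →ₗ[k] LamPoly S) (j : S →ₗ[k[X]] P) : Prop where
  finite : Module.Finite k[X] P
  finite_left : Module.Finite k[X] R
  finite_right : Module.Finite k[X] S
  total : IsLieConformal br
  left : IsLieConformal brR
  right : IsLieConformal brS
  hom_left : ∀ a b, br (i a) (i b) = mapLam (i.restrictScalars k) (brR a b)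
  hom_right : ∀ f g, br (j f) (j g) = mapLam (j.restrictScalars k) (brS f g)
  directSum : Function.Bijective (i.coprod j)
  form : IsInvariantConformalForm br F
  isotropic_left : ∀ a b, F (i a) (i b) = 0
  isotropic_right : ∀ f g, F (j f) (j g) = 0

/-! ## The Lie conformal bialgebra obtained from a Manin triple or from a matched pair -/

/-- `(R, brR, d)` is obtained from the conformal Manin triple `(P, R, S)`: the bracket of `R` is
that of `P`, and the cobracket is dual to the bracket of `S`, where `S` is paired with `R` by the
form: `⟨[f_μ g], a⟩_λ = ∑ ⟨f, a₁⟩_μ ⟨g, a₂⟩_{λ-μ}` for `d(a) = ∑ a₁ ⊗ a₂`. -/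
structure IsBialgebraOfManinTriple (br : P →ₗ[k] P →ₗ[k] LamPoly P)
    (F : P →ₗ[k] P →ₗ[k] k[X]) (i : R →ₗ[k[X]] P) (j : S →ₗ[k[X]] P)
    (brR : R →ₗ[k] R →ₗ[k] LamPoly R) (d : R →ₗ[k] R ⊗[k] R) : Prop where
  bracket : ∀ a b, mapLam (i.restrictScalars k) (brR a b) = br (i a) (i b)
  cobracket : ∀ f g a (l n : k),
    (F (ev n (br (j f) (j g))) (i a)).eval l =
      LinearMap.mul' k k (TensorProduct.map
        (Polynomial.leval n ∘ₗ F (j f) ∘ₗ i.restrictScalars k)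
        (Polynomial.leval (l - n) ∘ₗ F (j g) ∘ₗ i.restrictScalars k) (d a))

/-- `(R, brR, d)` is obtained from a matched pair `(R, R^{*c}, ρ, σ)` with matched bracket `br` on
`R ⊕ R^{*c}`: the bracket of `R` is that of the summand `R`, and the cobracket is dual to
the bracket of the summand `R^{*c}`: `[f_μ g]_λ(a) = ∑ f_μ(a₁) g_{λ-μ}(a₂)` for
`d(a) = ∑ a₁ ⊗ a₂`. -/
structure IsBialgebraOfMatchedPair
    (br : (R × ConfDual k R) →ₗ[k] (R × ConfDual k R) →ₗ[k] LamPoly (R × ConfDual k R))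
    (brR : R →ₗ[k] R →ₗ[k] LamPoly R) (d : R →ₗ[k] R ⊗[k] R) : Prop where
  bracket : ∀ a b, mapLam (LinearMap.inl k R (ConfDual k R)) (brR a b) = br (a, 0) (b, 0)
  cobracket : ∀ f g a (l n : k),
    (ev n (br (0, f) (0, g))).2.at l a
      = LinearMap.mul' k k (TensorProduct.map (f.at n) (g.at (l - n)) (d a))

end Conformal

/-! ## The passage from `A` to `k[∂]A` -/

section Correspondence

variable (k : Type*) [Field k]

/-- The free `k[∂]`-module `k[∂]A`. -/
abbrev FreeMod (A : Type*) [AddCommGroup A] [Module k A] := k[X] ⊗[k] A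

variable {k} {A : Type*} [AddCommGroup A] [Module k A]

variable (k A) in
/-- The inclusion `A → k[∂]A`. -/
def incl : A →ₗ[k] FreeMod k A := TensorProduct.mk k k[X] A 1

variable (k) in
/-- Multiplication by `λ` on `M[λ]`. -/
def lamMul (M : Type*) [AddCommGroup M] [Module k M] : Module.End k (LamPoly M) :=
  Finsupp.lmapDomain M k (· + 1)

/-- `∂(b∘a) + λ(a⋆b) + [a,b]` for `a, b ∈ A`, bilinear in `a` and `b`. -/
def gdGen (m br : A →ₗ[k] A →ₗ[k] A) : A →ₗ[k] A →ₗ[k] LamPoly (FreeMod k A) :=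
  m.flip.compr₂ (Finsupp.lsingle 0 ∘ₗ del k (FreeMod k A) ∘ₗ incl k A)
    + (starOp m).compr₂ (Finsupp.lsingle 1 ∘ₗ incl k A)
    + br.compr₂ (Finsupp.lsingle 0 ∘ₗ incl k A)

/-- The `λ`-bracket on `k[∂]A` attached to the operations of `A`: the sesquilinear extension
`[p(∂)a _λ q(∂)b] = p(-λ) q(λ+∂) [a_λ b]` of `[a_λ b] = ∂(b∘a) + λ(a⋆b) + [a,b]`. -/
def gdBracket (m br : A →ₗ[k] A →ₗ[k] A) :
    FreeMod k A →ₗ[k] FreeMod k A →ₗ[k] LamPoly (FreeMod k A) :=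
  TensorProduct.lift (LinearMap.mk₂ k
    (fun p a => TensorProduct.lift (LinearMap.mk₂ k
      (fun q b => aeval (-lamMul k (FreeMod k A)) p
        (aeval (lamMul k (FreeMod k A) + mapLam (del k (FreeMod k A))) q (gdGen m br a b)))
      (fun q q' b => by simp)
      (fun c q b => by simp)
      (fun q b b' => by simp)
      (fun c q b => by simp)))
    (fun p p' a => TensorProduct.ext' fun q b => by simp)
    (fun c p a => TensorProduct.ext' fun q b => by simp)
    (fun p a a' => TensorProduct.ext' fun q b => by simp)
    (fun c p a => TensorProduct.ext' fun q b => by simp))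

/-- `δ₀(a) + (∂ ⊗ id)Δ(a) - τ(∂ ⊗ id)Δ(a)` for `a ∈ A`. -/
def cobracketGen (D d : A →ₗ[k] A ⊗[k] A) : A →ₗ[k] FreeMod k A ⊗[k] FreeMod k A :=
  TensorProduct.map (incl k A) (incl k A) ∘ₗ d
    + onL (del k (FreeMod k A)) ∘ₗ TensorProduct.map (incl k A) (incl k A) ∘ₗ D
    - tau ∘ₗ onL (del k (FreeMod k A)) ∘ₗ TensorProduct.map (incl k A) (incl k A) ∘ₗ D

/-- The cobracket `δ` on `k[∂]A` attached to `Δ`, `δ₀`: the `k[∂]`-linear extension of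
`δ(a) = δ₀(a) + (∂ ⊗ id)Δ(a) - τ(∂ ⊗ id)Δ(a)`. -/
def cobracket (D d : A →ₗ[k] A ⊗[k] A) :
    FreeMod k A →ₗ[k] FreeMod k A ⊗[k] FreeMod k A :=
  TensorProduct.lift (LinearMap.mk₂ k
    (fun p a => aeval (del2 k (FreeMod k A)) p (cobracketGen D d a))
    (fun p p' a => by simp) (fun c p a => by simp)
    (fun p a a' => by simp) (fun c p a => by simp))

/-- The conformal bilinear form on `k[∂]A` extending a bilinear form on `A`:
`⟨p(∂)a, q(∂)b⟩_λ = p(-λ) q(λ) (a, b)`. -/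
def confForm (F : A →ₗ[k] A →ₗ[k] k) : FreeMod k A →ₗ[k] FreeMod k A →ₗ[k] k[X] :=
  TensorProduct.lift (LinearMap.mk₂ k
    (fun p a => TensorProduct.lift (LinearMap.mk₂ k
      (fun q b => twist k p * q * C (F a b))
      (fun q q' b => by ring)
      (fun c q b => by simp)
      (fun q b b' => by simp; ring)
      (fun c q b => by simp [smul_eq_C_mul]; ring)))
    (fun p p' a => TensorProduct.ext' fun q b => by simp; ring)
    (fun c p a => TensorProduct.ext' fun q b => by simp)
    (fun p a a' => TensorProduct.ext' fun q b => by simp; ring)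
    (fun c p a => TensorProduct.ext' fun q b => by simp [smul_eq_C_mul]; ring))

variable (k A) in
/-- The inclusion `k[∂]A → k[∂](A ⊕ A*)`. -/
def inA : FreeMod k A →ₗ[k[X]] FreeMod k (A × Module.Dual k A) :=
  (LinearMap.inl k A (Module.Dual k A)).baseChange k[X]

variable (k A) in
/-- The inclusion `k[∂]A* → k[∂](A ⊕ A*)`. -/
def inDual : FreeMod k (Module.Dual k A) →ₗ[k[X]] FreeMod k (A × Module.Dual k A) :=
  (LinearMap.inr k A (Module.Dual k A)).baseChange k[X]

variable (k A) in
/-- The `k`-linear isomorphism underlying `dualIso`. -/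
def dualIsoAux [FiniteDimensional k A] :
    FreeMod k (Module.Dual k A) ≃ₗ[k] (FreeMod k A →ₗ[k[X]] k[X]) :=
  (TensorProduct.comm k k[X] (Module.Dual k A))
    ≪≫ₗ (TensorProduct.congr (LinearEquiv.refl k (Module.Dual k A))
      (LinearEquiv.ofInvolutive (twist k).toLinearMap twist_twist))
    ≪≫ₗ (dualTensorHomEquiv k A k[X])
    ≪≫ₗ ((LinearMap.liftBaseChangeEquiv (R := k) (M := A) (N := k[X]) k[X]).restrictScalars k)

theorem dualIsoAux_tmul [FiniteDimensional k A] (p q : k[X]) (f : Module.Dual k A) (a : A) :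
    dualIsoAux k A (p ⊗ₜ f) (q ⊗ₜ a) = twist k p * q * C (f a) := by
  have h : dualIsoAux k A (p ⊗ₜ f) (q ⊗ₜ a) = q * (f a • twist k p) := by
    simp [dualIsoAux]
    rfl
  rw [h, smul_eq_C_mul]
  ring

theorem dualIsoAux_smul [FiniteDimensional k A] (p : k[X]) (F : FreeMod k (Module.Dual k A)) :
    dualIsoAux k A (p • F) = twist k p • dualIsoAux k A F := by
  induction F using TensorProduct.induction_on with
  | zero => simp
  | add F G hF hG => rw [smul_add, map_add, hF, hG, map_add, smul_add]
  | tmul r f =>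
    refine LinearMap.ext fun u => ?_
    induction u using TensorProduct.induction_on with
    | zero => simp
    | add u v hu hv => rw [map_add, map_add, hu, hv]
    | tmul q a =>
      rw [smul_tmul', LinearMap.smul_apply, dualIsoAux_tmul, dualIsoAux_tmul, smul_eq_mul,
        smul_eq_mul, map_mul]
      ring

variable (k A) in
/-- The isomorphism `k[∂]A* → (k[∂]A)^{*c}` given by `(p(∂)f)_λ (q(∂)a) = p(-λ) q(λ) f(a)`. -/
def dualIso [FiniteDimensional k A] :
    FreeMod k (Module.Dual k A) ≃ₗ[k[X]] ConfDual k (FreeMod k A) :=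
  { toFun := fun F => dualIsoAux k A F
    invFun := fun f => (dualIsoAux k A).symm f
    left_inv := (dualIsoAux k A).left_inv
    right_inv := (dualIsoAux k A).right_inv
    map_add' := fun F G => map_add (dualIsoAux k A) F G
    map_smul' := fun p F => dualIsoAux_smul p F }

/-- The `λ`-bracket on the conformal dual `(k[∂]A)^{*c} = k[∂]A*` attached to operations of `A*`. -/
def dualBracket [FiniteDimensional k A]
    (m' br' : Module.Dual k A →ₗ[k] Module.Dual k A →ₗ[k] Module.Dual k A) :
    ConfDual k (FreeMod k A) →ₗ[k] ConfDual k (FreeMod k A) →ₗ[k]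
      LamPoly (ConfDual k (FreeMod k A)) :=
  LinearMap.mk₂ k
    (fun f g => mapLam ((dualIso k A).toLinearMap.restrictScalars k)
      (gdBracket m' br' ((dualIso k A).symm f) ((dualIso k A).symm g)))
    (fun f f' g => by simp)
    (fun c f g => by
      rw [show (dualIso k A).symm (c • f) = c • (dualIso k A).symm f from
        ((dualIso k A).symm.restrictScalars k).map_smul c f]
      simp)
    (fun f g g' => by simp)
    (fun c f g => by
      rw [show (dualIso k A).symm (c • g) = c • (dualIso k A).symm g from
        ((dualIso k A).symm.restrictScalars k).map_smul c g]
      simp)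

variable (k A) in
/-- The canonical map `k[∂](A ⊕ A*) → k[∂]A ⊕ (k[∂]A)^{*c}`. -/
def splitIso [FiniteDimensional k A] :
    FreeMod k (A × Module.Dual k A) →ₗ[k[X]] FreeMod k A × ConfDual k (FreeMod k A) :=
  ((LinearMap.fst k A (Module.Dual k A)).baseChange k[X]).prod
    ((dualIso k A).toLinearMap ∘ₗ (LinearMap.snd k A (Module.Dual k A)).baseChange k[X])

end Correspondence
end
end GDConformal

open GDConformal

/-!
Everything is evaluated at scalars.  An element `u` of `k[∂]V` is a polynomial function `x ↦ u(x)`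
with values in `V`, and `k` is infinite, so identities can be checked on values.  On values the
`λ`-bracket of `k[∂]V` is the loop bracket `V_p × V_q → V_{p+q}`,
`(a, b) ↦ q b∘a - p a∘b + [a,b]`, with `p = -λ` (`evalAt_ev_gdBracket`); the cobracket is
`a ↦ δ₀(a) + x Δ(a) - y τΔ(a)`, and it is dual to the loop bracket of `A*` in degrees `-x`, `-y`
(`evalAt₂_cobracket`, `pair₂_loopCobr`).

The Jacobi defect of the loop bracket is quadratic in the three degrees, and its coefficients are
the defects of the axioms of a Gel'fand–Dorfman algebra; so these axioms are equivalent to the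
Jacobi identity of the loop bracket, and to those of a Lie conformal algebra for `k[∂]V`
(`isGDAlgebra_iff_loopJacobi`, `isLieConformal_gdBracket_iff`).  In the same way, the cocycle
condition of a Lie conformal bialgebra is quadratic in the degrees, and its coefficients are the
compatibilities of a Gel'fand–Dorfman bialgebra and their images under the flip
(`isGDBialgebra_iff_loopCocycle`, `isLieConformalBialgebra_iff_loopCocycle`).

All six conditions are compared with one: the double `A ⊕ A*`, with the products given by the
coadjoint actions, is a Gel'fand–Dorfman algebra.  Its loop bracket preserves the canonical form, so
the Jacobi identity paired with a fourth vector is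
`⟨[u,v],[w,z]⟩ + ⟨[v,w],[u,z]⟩ - ⟨[u,w],[v,z]⟩ = 0` up to sign, an alternating four-linear
condition.  Three arguments in `A`, or three in `A*`, give the Jacobi identities of `A` and of `A*`;
two in each give the cocycle condition (`isGDAlgebra_double_iff_loopCocycle`).  Operations on the
double for which the form is invariant are determined by their restrictions to the two isotropic
summands, which settles the two kinds of Manin triples (`IsManinTripleGD.eq_double`,
`IsConformalManinTriple.eq_double`).  Finally the canonical map from `k[∂](A ⊕ A*)` to
`R ⊕ R^{*c}` carries the `λ`-bracket of the double to the matched bracket of the coadjoint actions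
(`isMatchedBracket_iff`), and a cobracket is determined by its values, hence by the dual bracket
(`eq_cobracket_iff`).
-/

namespace GDConformal

/-! ### Polynomial identities over an infinite field -/

section Polynomials

variable {k : Type*} [Field k]
variable {M N : Type*} [AddCommGroup M] [Module k M] [AddCommGroup N] [Module k N]

/-- A vector-valued quadratic polynomial in three variables that vanishes identically has zero
coefficients. -/
theorem quadratic_coeff_eq_zero [CharZero k] {c₀ c₁ c₂ c₃ c₁₁ c₂₂ c₃₃ c₁₂ c₁₃ c₂₃ : M}
    (h : ∀ p q r : k, c₀ + p • c₁ + q • c₂ + r • c₃ + (p * p) • c₁₁ + (q * q) • c₂₂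
      + (r * r) • c₃₃ + (p * q) • c₁₂ + (p * r) • c₁₃ + (q * r) • c₂₃ = 0) :
    c₀ = 0 ∧ (c₁ = 0 ∧ c₂ = 0 ∧ c₃ = 0) ∧ (c₁₁ = 0 ∧ c₂₂ = 0 ∧ c₃₃ = 0) ∧
      (c₁₂ = 0 ∧ c₁₃ = 0 ∧ c₂₃ = 0) := by
  have h0 : c₀ = 0 := by simpa using h 0 0 0
  have key : ∀ u v : M, u + v = 0 → -u + v = 0 → u = 0 ∧ v = 0 := by
    intro u v h1 h2
    have hu : (2 : k) • u = 0 := by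
      linear_combination (norm := module) h1 - h2
    have : u = 0 := by simpa using hu
    exact ⟨this, by simpa [this] using h1⟩
  obtain ⟨h1, h11⟩ := key c₁ c₁₁ (by simpa [h0] using h 1 0 0) (by simpa [h0] using h (-1) 0 0)
  obtain ⟨h2, h22⟩ := key c₂ c₂₂ (by simpa [h0] using h 0 1 0) (by simpa [h0] using h 0 (-1) 0)
  obtain ⟨h3, h33⟩ := key c₃ c₃₃ (by simpa [h0] using h 0 0 1) (by simpa [h0] using h 0 0 (-1))
  refine ⟨h0, ⟨h1, h2, h3⟩, ⟨h11, h22, h33⟩, ?_, ?_, ?_⟩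
  · simpa [h0, h1, h2, h11, h22] using h 1 1 0
  · simpa [h0, h1, h3, h11, h33] using h 1 0 1
  · simpa [h0, h2, h3, h22, h33] using h 0 1 1

theorem map_pow_of_intertwine {φ : M →ₗ[k] N} {T : Module.End k M} {t : k}
    (h : ∀ v, φ (T v) = t • φ v) (n : ℕ) (v : M) : φ ((T ^ n) v) = t ^ n • φ v := by
  induction n with
  | zero => simp
  | succ n ih => rw [pow_succ', Module.End.mul_apply, h, ih, smul_smul, pow_succ']

/-- If `φ` turns `T` into the scalar `t`, it turns the substitution `λ = T` into `λ = t`. -/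
theorem map_subst_of_intertwine {φ : M →ₗ[k] N} {T : Module.End k M} {t : k}
    (h : ∀ v, φ (T v) = t • φ v) (w : LamPoly M) : φ (subst T w) = φ (ev t w) := by
  have h1 : φ ∘ₗ subst T = φ ∘ₗ ev t := by
    ext n v
    simp [ev, subst, map_pow_of_intertwine h, _root_.smul_pow]
  exact DFunLike.congr_fun h1 w

theorem map_aeval_of_intertwine {φ : M →ₗ[k] N} {T : Module.End k M} {t : k}
    (h : ∀ v, φ (T v) = t • φ v) (p : k[X]) (v : M) :
    φ (aeval T p v) = p.eval t • φ v := by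
  induction p using Polynomial.induction_on' with
  | add p q hp hq => simp [hp, hq, add_smul]
  | monomial n c => simp [aeval_monomial, map_pow_of_intertwine h, smul_smul]

theorem ev_single (l : k) (n : ℕ) (v : M) : ev l (Finsupp.single n v) = l ^ n • v := by
  simp [ev, subst, _root_.smul_pow]

theorem ev_mapLam (f : M →ₗ[k] N) (l : k) (w : LamPoly M) : ev l (mapLam f w) = f (ev l w) := by
  have h : ev l ∘ₗ mapLam f = f ∘ₗ ev l := by
    ext n v
    simp [mapLam, ev_single]
  exact DFunLike.congr_fun h w

theorem subst_mapLam {f : M →ₗ[k] N} {T : Module.End k M} {T' : Module.End k N}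
    (h : ∀ v, f (T v) = T' (f v)) (w : LamPoly M) :
    subst T' (mapLam f w) = f (subst T w) := by
  have hp : ∀ n v, f ((T ^ n) v) = (T' ^ n) (f v) := by
    intro n v
    induction n with
    | zero => simp
    | succ n ih => rw [pow_succ', Module.End.mul_apply, h, ih, pow_succ', Module.End.mul_apply]
  have h : subst T' ∘ₗ mapLam f = f ∘ₗ subst T := by
    ext n v
    simp [mapLam, subst, hp]
  exact DFunLike.congr_fun h w

theorem ev_lamMul (l : k) (w : LamPoly M) : ev l (lamMul k M w) = l • ev l w := by
  have h : ev l ∘ₗ lamMul k M = l • ev l := by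
    ext n v
    simp [lamMul, Finsupp.lmapDomain, Finsupp.mapDomain_single, ev_single, pow_succ', smul_smul]
  exact DFunLike.congr_fun h w

/-- A polynomial in `λ` with coefficients in a vector space is determined by its values. -/
theorem LamPoly.ext_ev [Infinite k] {w w' : LamPoly M} (h : ∀ l : k, ev l w = ev l w') :
    w = w' := by
  rw [← sub_eq_zero]
  set z := w - w' with hz
  have hz0 : ∀ l : k, ev l z = 0 := fun l => by rw [hz, map_sub, h, sub_self]
  ext n
  rw [Finsupp.zero_apply, ← Module.forall_dual_apply_eq_zero_iff k]
  intro φ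
  have hpoly : (z.sum fun n v => Polynomial.monomial n (φ v)) = 0 := by
    refine Polynomial.funext fun l => ?_
    have := congrArg φ (hz0 l)
    rw [map_zero, ev, subst, Finsupp.lsum_apply, Finsupp.sum, map_sum] at this
    rw [Finsupp.sum, Polynomial.eval_finsetSum, Polynomial.eval_zero, ← this]
    refine Finset.sum_congr rfl fun i _ => ?_
    simp [_root_.smul_pow, mul_comm]
  have := congrArg (fun p => p.coeff n) hpoly
  simp only [Finsupp.sum, Polynomial.finsetSum_coeff, Polynomial.coeff_monomial,
    Polynomial.coeff_zero, Finset.sum_ite_eq'] at this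
  by_contra hne
  rw [if_pos (by rw [Finsupp.mem_support_iff]; rintro h0; exact hne (by rw [h0, map_zero]))] at this
  exact hne this

end Polynomials

/-! ### Jointly injective families and tensor products -/

section Tensor

variable {k : Type*} [Field k]
variable {M N : Type*} [AddCommGroup M] [Module k M] [AddCommGroup N] [Module k N]

theorem eq_zero_of_map_id_right {ι : Type*} {P : ι → Type*} [∀ i, AddCommGroup (P i)]
    [∀ i, Module k (P i)] {φ : ∀ i, M →ₗ[k] P i} (hφ : ∀ u, (∀ i, φ i u = 0) → u = 0)
    {w : M ⊗[k] N} (h : ∀ i, TensorProduct.map (φ i) LinearMap.id w = 0) : w = 0 := by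
  classical
  let b := Module.Basis.ofVectorSpace k N
  refine (TensorProduct.equivFinsuppOfBasisRight (M := M) b).map_eq_zero_iff.1 ?_
  ext s
  refine hφ _ fun i => ?_
  have key : ∀ w : M ⊗[k] N, φ i (TensorProduct.equivFinsuppOfBasisRight b w s)
      = TensorProduct.equivFinsuppOfBasisRight b (TensorProduct.map (φ i) LinearMap.id w) s := by
    intro w
    induction w using TensorProduct.induction_on with
    | zero => simp
    | add x y hx hy => simp [hx, hy]
    | tmul x y => simp
  rw [key, h]
  simp

theorem eq_zero_of_map_id_left {ι : Type*} {P : ι → Type*} [∀ i, AddCommGroup (P i)]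
    [∀ i, Module k (P i)] {φ : ∀ i, N →ₗ[k] P i} (hφ : ∀ u, (∀ i, φ i u = 0) → u = 0)
    {w : M ⊗[k] N} (h : ∀ i, TensorProduct.map LinearMap.id (φ i) w = 0) : w = 0 := by
  refine (TensorProduct.comm k M N).map_eq_zero_iff.1 (eq_zero_of_map_id_right hφ fun i => ?_)
  rw [TensorProduct.map_comm, h, map_zero]

/-- Tensor products of jointly injective families are jointly injective. -/
theorem eq_zero_of_map {ι κ : Type*} {P : ι → Type*} [∀ i, AddCommGroup (P i)]
    [∀ i, Module k (P i)] {Q : κ → Type*} [∀ i, AddCommGroup (Q i)] [∀ i, Module k (Q i)]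
    {φ : ∀ i, M →ₗ[k] P i} (hφ : ∀ u, (∀ i, φ i u = 0) → u = 0)
    {ψ : ∀ i, N →ₗ[k] Q i} (hψ : ∀ u, (∀ i, ψ i u = 0) → u = 0)
    {w : M ⊗[k] N} (h : ∀ i j, TensorProduct.map (φ i) (ψ j) w = 0) : w = 0 := by
  refine eq_zero_of_map_id_left hψ fun j => eq_zero_of_map_id_right hφ fun i => ?_
  rw [← LinearMap.comp_apply, ← TensorProduct.map_comp, LinearMap.id_comp, LinearMap.comp_id, h]

/-- Pure tensors of functionals separate the points of `M ⊗ N`. -/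
theorem eq_of_dualDistrib {w w' : M ⊗[k] N}
    (h : ∀ (f : Module.Dual k M) (g : Module.Dual k N),
      TensorProduct.dualDistrib k M N (f ⊗ₜ g) w = TensorProduct.dualDistrib k M N (f ⊗ₜ g) w') :
    w = w' := by
  rw [← sub_eq_zero]
  refine eq_zero_of_map (φ := fun f : Module.Dual k M => f) (ψ := fun g : Module.Dual k N => g)
    (fun u => (Module.forall_dual_apply_eq_zero_iff k u).1)
    (fun u => (Module.forall_dual_apply_eq_zero_iff k u).1) fun f g => ?_
  rw [← (TensorProduct.lid k k).map_eq_zero_iff]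
  have := sub_eq_zero.2 (h f g)
  rw [← map_sub] at this
  simpa [TensorProduct.dualDistrib] using this

end Tensor

/-! ### Values of elements of `k[∂]V` -/

section Values

variable {k : Type*} [Field k] {V W : Type*} [AddCommGroup V] [Module k V]
  [AddCommGroup W] [Module k W]

/-- The value `u(x) ∈ V` of `u ∈ k[∂]V` at `∂ = x`: `p(∂)a ↦ p(x)a`. -/
noncomputable def evalAt (x : k) : FreeMod k V →ₗ[k] V :=
  (TensorProduct.lid k V).toLinearMap ∘ₗ TensorProduct.map (Polynomial.leval x) LinearMap.id

@[simp] theorem evalAt_tmul (x : k) (p : k[X]) (a : V) :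
    evalAt x (p ⊗ₜ[k] a) = p.eval x • a := by simp [evalAt]

@[simp] theorem evalAt_incl (x : k) (a : V) : evalAt x (incl k V a) = a := by simp [incl]

@[simp] theorem evalAt_smul (x : k) (p : k[X]) (u : FreeMod k V) :
    evalAt x (p • u) = p.eval x • evalAt x u := by
  induction u using TensorProduct.induction_on with
  | zero => simp
  | add u v hu hv => rw [smul_add, map_add, hu, hv, map_add, smul_add]
  | tmul q a => simp [smul_tmul', smul_smul]

@[simp] theorem evalAt_del (x : k) (u : FreeMod k V) :
    evalAt x (del k (FreeMod k V) u) = x • evalAt x u := by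
  simp [del]

@[simp] theorem evalAt_baseChange (φ : V →ₗ[k] W) (x : k) (u : FreeMod k V) :
    evalAt x (φ.baseChange k[X] u) = φ (evalAt x u) := by
  induction u using TensorProduct.induction_on with
  | zero => simp
  | add u v hu hv => simp [hu, hv]
  | tmul q a => simp

theorem eq_zero_of_evalAt [Infinite k] {u : FreeMod k V} (h : ∀ x : k, evalAt x u = 0) :
    u = 0 := by
  refine eq_zero_of_map_id_right (φ := fun x : k => Polynomial.leval x)
    (fun p hp => Polynomial.funext fun x => by simpa using hp x) fun x => ?_
  rw [← (TensorProduct.lid k V).map_eq_zero_iff]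
  exact h x

/-- An element of `k[∂]V` is determined by its values. -/
theorem FreeMod.ext_evalAt [Infinite k] {u v : FreeMod k V} (h : ∀ x : k, evalAt x u = evalAt x v) :
    u = v := by
  rw [← sub_eq_zero]
  exact eq_zero_of_evalAt fun x => by rw [map_sub, h, sub_self]

/-- A polynomial in `λ` over `k[∂]V` is determined by its values at `λ = l`, `∂ = x`. -/
theorem FreeMod.ext_ev_evalAt [Infinite k] {w w' : LamPoly (FreeMod k V)}
    (h : ∀ l x : k, evalAt x (ev l w) = evalAt x (ev l w')) : w = w' :=
  LamPoly.ext_ev fun l => FreeMod.ext_evalAt fun x => h l x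

theorem evalAt_subst_sub_del (c x : k) (w : LamPoly (FreeMod k V)) :
    evalAt x (subst (c • 1 - del k (FreeMod k V)) w) = evalAt x (ev (c - x) w) :=
  map_subst_of_intertwine (fun v => by simp [sub_smul]) w

theorem evalAt_subst_neg_sub_del (c x : k) (w : LamPoly (FreeMod k V)) :
    evalAt x (subst (-(c • 1) - del k (FreeMod k V)) w) = evalAt x (ev (-c - x) w) :=
  map_subst_of_intertwine (fun v => by simp [sub_smul]) w

/-- The value at `∂ ⊗ id = x`, `id ⊗ ∂ = y` of an element of `k[∂]V ⊗ k[∂]V`. -/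
noncomputable def evalAt₂ (x y : k) : FreeMod k V ⊗[k] FreeMod k V →ₗ[k] V ⊗[k] V :=
  TensorProduct.map (evalAt x) (evalAt y)

@[simp] theorem evalAt₂_tmul (x y : k) (u v : FreeMod k V) :
    evalAt₂ x y (u ⊗ₜ[k] v) = evalAt x u ⊗ₜ evalAt y v := by simp [evalAt₂]

theorem eq_zero_of_evalAt₂ [Infinite k] {w : FreeMod k V ⊗[k] FreeMod k V}
    (h : ∀ x y : k, evalAt₂ x y w = 0) : w = 0 :=
  eq_zero_of_map (fun _ => eq_zero_of_evalAt) (fun _ => eq_zero_of_evalAt) h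

theorem ext_evalAt₂ [Infinite k] {w w' : FreeMod k V ⊗[k] FreeMod k V}
    (h : ∀ x y : k, evalAt₂ x y w = evalAt₂ x y w') : w = w' := by
  rw [← sub_eq_zero]
  exact eq_zero_of_evalAt₂ fun x y => by rw [map_sub, h, sub_self]

@[simp] theorem evalAt₂_onL_del (x y : k) (w : FreeMod k V ⊗[k] FreeMod k V) :
    evalAt₂ x y (onL (del k (FreeMod k V)) w) = x • evalAt₂ x y w := by
  induction w using TensorProduct.induction_on with
  | zero => simp
  | add u v hu hv => simp only [map_add, hu, hv, smul_add]
  | tmul u v => simp [onL, smul_tmul']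

@[simp] theorem evalAt₂_onR_del (x y : k) (w : FreeMod k V ⊗[k] FreeMod k V) :
    evalAt₂ x y (onR (del k (FreeMod k V)) w) = y • evalAt₂ x y w := by
  induction w using TensorProduct.induction_on with
  | zero => simp
  | add u v hu hv => simp only [map_add, hu, hv, smul_add]
  | tmul u v => simp [onR]

@[simp] theorem evalAt₂_del2 (x y : k) (w : FreeMod k V ⊗[k] FreeMod k V) :
    evalAt₂ x y (del2 k (FreeMod k V) w) = (x + y) • evalAt₂ x y w := by
  simp [del2, add_smul]

@[simp] theorem evalAt₂_tau (x y : k) (w : FreeMod k V ⊗[k] FreeMod k V) :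
    evalAt₂ x y (tau w) = tau (evalAt₂ y x w) := by
  induction w using TensorProduct.induction_on with
  | zero => simp
  | add u v hu hv => simp only [map_add, hu, hv]
  | tmul u v => simp [tau]

/-- The value of an element of `k[∂]V ⊗ k[∂]V ⊗ k[∂]V` with `x`, `y`, `z` for the three `∂`. -/
noncomputable def evalAt₃ (x y z : k) :
    FreeMod k V ⊗[k] (FreeMod k V ⊗[k] FreeMod k V) →ₗ[k] V ⊗[k] (V ⊗[k] V) :=
  TensorProduct.map (evalAt x) (evalAt₂ y z)

theorem ext_evalAt₃ [Infinite k] {w w' : FreeMod k V ⊗[k] (FreeMod k V ⊗[k] FreeMod k V)}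
    (h : ∀ x y z : k, evalAt₃ x y z w = evalAt₃ x y z w') : w = w' := by
  rw [← sub_eq_zero]
  refine eq_zero_of_map (φ := fun x : k => evalAt x) (ψ := fun p : k × k => evalAt₂ p.1 p.2)
    (fun _ => eq_zero_of_evalAt) (fun _ h => eq_zero_of_evalAt₂ fun x y => h (x, y))
    fun x p => ?_
  rw [map_sub, sub_eq_zero]
  exact h x p.1 p.2

@[simp] theorem evalAt₃_tau12 (x y z : k) (w : FreeMod k V ⊗[k] (FreeMod k V ⊗[k] FreeMod k V)) :
    evalAt₃ x y z (tau12 w) = tau12 (evalAt₃ y x z w) := by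
  have h : evalAt₃ x y z ∘ₗ tau12 (k := k) (A := FreeMod k V) = tau12 ∘ₗ evalAt₃ y x z := by
    refine TensorProduct.ext' fun u w => ?_
    induction w using TensorProduct.induction_on with
    | zero => simp
    | add u v hu hv => simp only [tmul_add, map_add, hu, hv]
    | tmul v w => simp [tau12, evalAt₃]
  exact DFunLike.congr_fun h w

end Values

/-! ### The loop bracket and the Gel'fand–Dorfman correspondence -/

section Loop

variable {k : Type*} [Field k] {V : Type*} [AddCommGroup V] [Module k V]

/-- The value of the `λ`-bracket of `k[∂]V` at scalars: the bracket
`V_p × V_q → V_{p+q}`, `(a, b) ↦ q b∘a - p a∘b + [a,b]`, where `V_p` is the fibre of `k[∂]V` at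
`∂ = p`. The output `∂ = p + q` corresponds to `λ = -p`. -/
noncomputable def loopBr (m br : V →ₗ[k] V →ₗ[k] V) (p q : k) : V →ₗ[k] V →ₗ[k] V :=
  q • m.flip - p • m + br

theorem loopBr_apply (m br : V →ₗ[k] V →ₗ[k] V) (p q : k) (a b : V) :
    loopBr m br p q a b = q • m b a - p • m a b + br a b := rfl

/-- The Jacobi identity of the loop bracket, for all degrees `p`, `q`, `r`. -/
def LoopJacobi (m br : V →ₗ[k] V →ₗ[k] V) : Prop :=
  ∀ (p q r : k) (a b c : V), loopBr m br p (q + r) a (loopBr m br q r b c)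
    = loopBr m br (p + q) r (loopBr m br p q a b) c
      + loopBr m br q (p + r) b (loopBr m br p r a c)

theorem br_swap {br : V →ₗ[k] V →ₗ[k] V} (h : ∀ a, br a a = 0) (a b : V) :
    br a b = - br b a := by
  have := h (a + b)
  simp only [map_add, LinearMap.add_apply, h, zero_add, add_zero] at this
  exact eq_neg_of_add_eq_zero_right this

theorem loopBr_swap {m br : V →ₗ[k] V →ₗ[k] V} (h : ∀ a, br a a = 0) (p q : k) (a b : V) :
    loopBr m br p q a b = - loopBr m br q p b a := by
  rw [loopBr_apply, loopBr_apply, br_swap h a b]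
  abel

/-- The Jacobi defect of the loop bracket is a quadratic polynomial in the degrees, whose
coefficients are the defects of the axioms of a Gel'fand–Dorfman algebra. -/
theorem loopJacobi_defect (m br : V →ₗ[k] V →ₗ[k] V) (p q r : k) (a b c : V) :
    loopBr m br p (q + r) a (loopBr m br q r b c)
      - (loopBr m br (p + q) r (loopBr m br p q a b) c
        + loopBr m br q (p + r) b (loopBr m br p r a c))
    = (br a (br b c) - br (br a b) c - br b (br a c))
      + p • (-m a (br b c) + m (br a b) c + br (m a b) c - m (br a c) b + br b (m a c))
      + q • (m (br b c) a - br a (m b c) + m (br a b) c - br (m b a) c + m b (br a c))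
      + r • (m (br b c) a + br a (m c b) - m c (br a b) - m (br a c) b - br b (m c a))
      + (p * p) • (m (m a c) b - m (m a b) c)
      + (q * q) • (m (m b a) c - m (m b c) a)
      + (r * r) • (m (m c b) a - m (m c a) b)
      + (p * q) • (m a (m b c) + m (m b a) c - m (m a b) c - m b (m a c))
      + (p * r) • (-m a (m c b) + m c (m a b) - m (m c a) b + m (m a c) b)
      + (q * r) • (m (m c b) a - m (m b c) a - m c (m b a) + m b (m c a)) := by
  simp only [loopBr_apply, map_add, map_sub, map_smul, LinearMap.add_apply, LinearMap.sub_apply,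
    LinearMap.smul_apply]
  module

/-- Gel'fand–Dorfman algebras are the pairs of operations whose loop bracket is a Lie bracket. -/
theorem isGDAlgebra_iff_loopJacobi [CharZero k] {m br : V →ₗ[k] V →ₗ[k] V} :
    IsGDAlgebra m br ↔ (∀ a, br a a = 0) ∧ LoopJacobi m br := by
  constructor
  · intro h
    refine ⟨h.lie.alternating, fun p q r a b c => sub_eq_zero.1 ?_⟩
    have sk := br_swap h.lie.alternating
    have hr := h.novikov.right_comm
    have e0 : br a (br b c) - br (br a b) c - br b (br a c) = 0 := by
      rw [h.lie.jacobi a b c]; abel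
    have e1 := h.compat a b c
    have e2 := h.compat b a c
    have e3 := h.compat c a b
    rw [sk (m a c) b] at e1
    rw [sk (m b c) a, sk b a, map_neg, LinearMap.neg_apply] at e2
    rw [sk (m c a) b, sk (m c b) a, sk c a, sk c b, map_neg, map_neg, LinearMap.neg_apply,
      LinearMap.neg_apply] at e3
    have f1 := h.novikov.left_symm a b c
    have f2 := h.novikov.left_symm a c b
    have f3 := h.novikov.left_symm b c a
    rw [loopJacobi_defect, e0]
    linear_combination (norm := module) p • e1 - q • e2 + r • e3 + (p * p) • hr a c b
      + (q * q) • hr b a c + (r * r) • hr c b a - (p * q) • f1 + (p * r) • f2 - (q * r) • f3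
  · rintro ⟨h0, hJ⟩
    have sk := br_swap h0
    have key := fun a b c => quadratic_coeff_eq_zero (k := k) fun p q r => by
      rw [← loopJacobi_defect m br p q r a b c]
      exact sub_eq_zero.2 (hJ p q r a b c)
    refine ⟨⟨fun a b c => ?_, fun a b c => ?_⟩, ⟨h0, fun a b c => ?_⟩, fun a b c => ?_⟩
    · have := (key a b c).2.2.2.1
      linear_combination (norm := module) -this
    · have := (key a b c).2.2.1.1
      linear_combination (norm := module) -this
    · have := (key a b c).1
      linear_combination (norm := module) this
    · have := (key a b c).2.1.1
      rw [sk (m a c) b]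
      linear_combination (norm := module) this

/-- The values of the `λ`-bracket of `k[∂]V` are given by the loop bracket. -/
theorem evalAt_ev_gdBracket (m br : V →ₗ[k] V →ₗ[k] V) (l x : k) (u v : FreeMod k V) :
    evalAt x (ev l (gdBracket m br u v))
      = loopBr m br (-l) (l + x) (evalAt (-l) u) (evalAt (l + x) v) := by
  induction u using TensorProduct.induction_on with
  | zero => simp
  | add u u' hu hu' => simp only [map_add, LinearMap.add_apply, hu, hu']
  | tmul p a =>
  induction v using TensorProduct.induction_on with
  | zero => simp
  | add v v' hv hv' => simp only [map_add, hv, hv']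
  | tmul q b =>
    have h : gdBracket m br (p ⊗ₜ a) (q ⊗ₜ b) = aeval (-lamMul k (FreeMod k V)) p
        (aeval (lamMul k (FreeMod k V) + mapLam (del k (FreeMod k V))) q (gdGen m br a b)) := rfl
    have h1 : ∀ w, (evalAt x ∘ₗ ev l) ((-lamMul k (FreeMod k V)) w)
        = (-l) • (evalAt x ∘ₗ ev l) w := fun w => by simp [ev_lamMul]
    have h2 : ∀ w, (evalAt x ∘ₗ ev l)
        ((lamMul k (FreeMod k V) + mapLam (del k (FreeMod k V))) w)
        = (l + x) • (evalAt x ∘ₗ ev l) w := fun w => by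
      simp [ev_lamMul, ev_mapLam, add_smul]
    rw [h, ← LinearMap.comp_apply (evalAt x), map_aeval_of_intertwine h1,
      map_aeval_of_intertwine h2]
    simp only [gdGen, LinearMap.comp_apply, LinearMap.add_apply, LinearMap.compr₂_apply, map_add,
      Finsupp.lsingle_apply, ev_single, evalAt_del, evalAt_incl, LinearMap.flip_apply, starOp,
      evalAt_tmul, map_smul, LinearMap.smul_apply, loopBr_apply]
    module

/-- `k[∂]V` with the `λ`-bracket of `(V, ∘, [·,·])` is a Lie conformal algebra if and only if
`(V, ∘, [·,·])` is a Gel'fand–Dorfman algebra. -/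
theorem isLieConformal_gdBracket_iff [CharZero k] {m br : V →ₗ[k] V →ₗ[k] V} :
    IsLieConformal (gdBracket m br) ↔ IsGDAlgebra m br := by
  rw [isGDAlgebra_iff_loopJacobi]
  constructor
  · intro h
    refine ⟨fun a => ?_, fun p q r a b c => ?_⟩
    · have := congrArg (evalAt (0 : k)) (h.skew (incl k V a) (incl k V a) 0)
      rw [map_neg, evalAt_subst_neg_sub_del, evalAt_ev_gdBracket, evalAt_ev_gdBracket] at this
      simp only [neg_zero, sub_zero, add_zero, loopBr_apply, zero_smul, zero_add,
        evalAt_incl] at this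
      have h2 : (2 : k) • br a a = 0 := by linear_combination (norm := module) this
      simpa using h2
    · have := congrArg (evalAt (p + q + r))
        (h.jacobi (incl k V a) (incl k V b) (incl k V c) (-p) (-q))
      simp only [map_add, evalAt_ev_gdBracket, evalAt_incl] at this
      convert this using 3 <;> ring_nf
  · rintro ⟨h0, hJ⟩
    refine ⟨⟨fun a v l => ?_, fun a v l => ?_⟩, fun a b l => ?_, fun a b c l n => ?_⟩
    · refine FreeMod.ext_evalAt fun x : k => ?_
      simp [evalAt_ev_gdBracket]
    · refine FreeMod.ext_evalAt fun x : k => ?_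
      simp [evalAt_ev_gdBracket, add_smul]
    · refine FreeMod.ext_evalAt fun x : k => ?_
      rw [map_neg, evalAt_subst_neg_sub_del, evalAt_ev_gdBracket, evalAt_ev_gdBracket,
        loopBr_swap h0]
      ring_nf
    · refine FreeMod.ext_evalAt fun x : k => ?_
      have := hJ (-l) (-n) (l + n + x) (evalAt (-l) a) (evalAt (-n) b) (evalAt (l + n + x) c)
      simp only [map_add, evalAt_ev_gdBracket]
      convert this using 3 <;> ring_nf

end Loop

/-! ### Dual operations and the cobracket -/

section Dual

variable {k : Type*} [Field k] {V : Type*} [AddCommGroup V] [Module k V]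

/-- The number `⟨f ⊗ g, w⟩`. -/
noncomputable def pair₂ (f g : Module.Dual k V) : V ⊗[k] V →ₗ[k] k :=
  TensorProduct.dualDistrib k V V (f ⊗ₜ g)

@[simp] theorem pair₂_tmul (f g : Module.Dual k V) (a b : V) :
    pair₂ f g (a ⊗ₜ[k] b) = f a * g b := by simp [pair₂]

theorem ext_pair₂ {w w' : V ⊗[k] V} (h : ∀ f g, pair₂ f g w = pair₂ f g w') : w = w' :=
  eq_of_dualDistrib h

theorem dualOp_apply (D : V →ₗ[k] V ⊗[k] V) (f g : Module.Dual k V) (a : V) :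
    dualOp D f g a = pair₂ f g (D a) := rfl

@[simp] theorem pair₂_tau (f g : Module.Dual k V) (w : V ⊗[k] V) :
    pair₂ f g (tau w) = pair₂ g f w := by
  induction w using TensorProduct.induction_on with
  | zero => simp
  | add u v hu hv => simp only [map_add, hu, hv]
  | tmul u v => simp [tau, mul_comm]

@[simp] theorem pair₂_onL (f g : Module.Dual k V) (φ : V →ₗ[k] V) (w : V ⊗[k] V) :
    pair₂ f g (onL φ w) = pair₂ (f ∘ₗ φ) g w := by
  induction w using TensorProduct.induction_on with
  | zero => simp
  | add u v hu hv => simp only [map_add, hu, hv]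
  | tmul u v => simp [onL]

@[simp] theorem pair₂_onR (f g : Module.Dual k V) (φ : V →ₗ[k] V) (w : V ⊗[k] V) :
    pair₂ f g (onR φ w) = pair₂ f (g ∘ₗ φ) w := by
  induction w using TensorProduct.induction_on with
  | zero => simp
  | add u v hu hv => simp only [map_add, hu, hv]
  | tmul u v => simp [onR]

/-- The number `⟨f ⊗ g ⊗ h, w⟩`. -/
noncomputable def pair₃ (f g h : Module.Dual k V) : V ⊗[k] (V ⊗[k] V) →ₗ[k] k :=
  TensorProduct.dualDistrib k V (V ⊗[k] V) (f ⊗ₜ pair₂ g h)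

@[simp] theorem pair₃_tmul (f g h : Module.Dual k V) (a b c : V) :
    pair₃ f g h (a ⊗ₜ[k] (b ⊗ₜ[k] c)) = f a * (g b * h c) := by simp [pair₃]

theorem ext_pair₃ {w w' : V ⊗[k] (V ⊗[k] V)} (h : ∀ f g e, pair₃ f g e w = pair₃ f g e w') :
    w = w' := by
  rw [← sub_eq_zero]
  refine eq_zero_of_map (φ := fun f : Module.Dual k V => f)
    (ψ := fun p : Module.Dual k V × Module.Dual k V => pair₂ p.1 p.2)
    (fun u => (Module.forall_dual_apply_eq_zero_iff k u).1)
    (fun u hu => ext_pair₂ fun f g => by simpa using hu (f, g)) fun f p => ?_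
  refine (TensorProduct.lid k k).map_eq_zero_iff.1 ?_
  have := sub_eq_zero.2 (h f p.1 p.2)
  rw [← map_sub] at this
  simpa [TensorProduct.dualDistrib, pair₃] using this

@[simp] theorem pair₃_tau12 (f g h : Module.Dual k V) (w : V ⊗[k] (V ⊗[k] V)) :
    pair₃ f g h (tau12 w) = pair₃ g f h w := by
  have h : pair₃ f g h ∘ₗ tau12 (k := k) (A := V) = pair₃ g f h := by
    refine TensorProduct.ext' fun u w => ?_
    induction w using TensorProduct.induction_on with
    | zero => simp
    | add u v hu hv => simp only [tmul_add, map_add, hu, hv]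
    | tmul v w => simp [tau12]; ring
  exact DFunLike.congr_fun h w

@[simp] theorem pair₃_idT (f g h : Module.Dual k V) (D : V →ₗ[k] V ⊗[k] V) (w : V ⊗[k] V) :
    pair₃ f g h (idT D w) = pair₂ f (dualOp D g h) w := by
  induction w using TensorProduct.induction_on with
  | zero => simp
  | add u v hu hv => simp only [map_add, hu, hv]
  | tmul u v => simp [idT, pair₃, dualOp_apply]

@[simp] theorem pair₃_tId (f g h : Module.Dual k V) (D : V →ₗ[k] V ⊗[k] V) (w : V ⊗[k] V) :
    pair₃ f g h (tId D w) = pair₂ (dualOp D f g) h w := by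
  have key : ∀ (t : V ⊗[k] V) (c : V), pair₃ f g h (TensorProduct.assoc k V V V (t ⊗ₜ c))
      = pair₂ f g t * h c := by
    intro t c
    induction t using TensorProduct.induction_on with
    | zero => simp
    | add u v hu hv => simp only [add_tmul, map_add, hu, hv, add_mul]
    | tmul u v => simp [mul_assoc]
  induction w using TensorProduct.induction_on with
  | zero => simp
  | add u v hu hv => simp only [map_add, hu, hv]
  | tmul u v => simp [tId, key, dualOp_apply]

/-- The dual of a Gel'fand–Dorfman coalgebra is a Gel'fand–Dorfman algebra. -/
theorem IsGDCoalgebra.dual [CharZero k] {D d : V →ₗ[k] V ⊗[k] V} (h : IsGDCoalgebra D d) :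
    IsGDAlgebra (dualOp D) (dualOp d) := by
  have alt : ∀ f, dualOp d f f = 0 := fun f => LinearMap.ext fun a => by
    have h1 := congrArg (pair₂ f f) (h.lie.skew a)
    rw [map_neg, pair₂_tau] at h1
    rw [dualOp_apply, LinearMap.zero_apply]
    exact self_eq_neg.1 h1
  refine ⟨⟨fun f g e => ?_, fun f g e => ?_⟩, ⟨alt, fun f g e => ?_⟩, fun f g e => ?_⟩ <;>
    refine LinearMap.ext fun a => ?_
  · have := congrArg (pair₃ f g e) (h.novikov.left_symm a)
    simp only [map_sub, pair₃_tau12, pair₃_idT, pair₃_tId, ← dualOp_apply] at this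
    simp only [LinearMap.sub_apply]
    linear_combination -this
  · have := congrArg (pair₃ f g e) (h.novikov.right_comm a)
    simp only [pair₃_tau12, pair₃_idT, pair₃_tId, pair₂_tau, ← dualOp_apply] at this
    exact this.symm
  · have := congrArg (pair₃ f g e) (h.lie.jacobi a)
    simp only [map_sub, pair₃_tau12, pair₃_idT, pair₃_tId, ← dualOp_apply] at this
    simp only [LinearMap.add_apply]
    linear_combination this
  · have := congrArg (pair₃ f g e) (h.compat a)
    simp only [map_sub, map_add, pair₃_tau12, pair₃_idT, pair₃_tId, pair₂_tau,
      ← dualOp_apply] at this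
    rw [br_swap alt (dualOp D f e) g]
    simp only [LinearMap.sub_apply, LinearMap.add_apply, LinearMap.neg_apply, LinearMap.zero_apply]
    linear_combination -this

/-- The value of the cobracket of `k[∂]V` at scalars: `a ↦ δ₀(a) + x Δ(a) - y τΔ(a)`. -/
noncomputable def loopCobr (D d : V →ₗ[k] V ⊗[k] V) (x y : k) : V →ₗ[k] V ⊗[k] V :=
  d + x • D - y • (tau ∘ₗ D)

theorem loopCobr_apply (D d : V →ₗ[k] V ⊗[k] V) (x y : k) (a : V) :
    loopCobr D d x y a = d a + x • D a - y • tau (D a) := rfl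

/-- The bracket dual to the value of the cobracket is the loop bracket of the dual operations. -/
theorem dualOp_loopCobr (D d : V →ₗ[k] V ⊗[k] V) (x y : k) (f g : Module.Dual k V) :
    dualOp (loopCobr D d x y) f g = loopBr (dualOp D) (dualOp d) (-x) (-y) f g := by
  ext a
  simp [dualOp_apply, loopCobr_apply, loopBr_apply]
  ring

theorem pair₂_loopCobr (D d : V →ₗ[k] V ⊗[k] V) (x y : k) (f g : Module.Dual k V) (a : V) :
    pair₂ f g (loopCobr D d x y a) = loopBr (dualOp D) (dualOp d) (-x) (-y) f g a := by
  rw [← dualOp_loopCobr, dualOp_apply]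

theorem evalAt₂_cobracket (D d : V →ₗ[k] V ⊗[k] V) (x y : k) (u : FreeMod k V) :
    evalAt₂ x y (cobracket D d u) = loopCobr D d x y (evalAt (x + y) u) := by
  induction u using TensorProduct.induction_on with
  | zero => simp
  | add u v hu hv => simp only [map_add, hu, hv]
  | tmul p a =>
    have hi : ∀ x y (w : V ⊗[k] V),
        evalAt₂ x y (TensorProduct.map (incl k V) (incl k V) w) = w := by
      intro x y w
      induction w using TensorProduct.induction_on with
      | zero => simp
      | add u v hu hv => simp only [map_add, hu, hv]
      | tmul u v => simp
    have h : cobracket D d (p ⊗ₜ a) = aeval (del2 k (FreeMod k V)) p (cobracketGen D d a) := rfl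
    rw [h, map_aeval_of_intertwine (evalAt₂_del2 x y), evalAt_tmul, map_smul]
    simp [cobracketGen, loopCobr_apply, hi]

theorem evalAt₃_idT (D d : V →ₗ[k] V ⊗[k] V) (x y z : k) (w : FreeMod k V ⊗[k] FreeMod k V) :
    evalAt₃ x y z (idT (cobracket D d) w) = idT (loopCobr D d y z) (evalAt₂ x (y + z) w) := by
  induction w using TensorProduct.induction_on with
  | zero => simp
  | add u v hu hv => simp only [map_add, hu, hv]
  | tmul u v => simp [idT, evalAt₃, evalAt₂_cobracket]

theorem evalAt₃_tId (D d : V →ₗ[k] V ⊗[k] V) (x y z : k) (w : FreeMod k V ⊗[k] FreeMod k V) :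
    evalAt₃ x y z (tId (cobracket D d) w) = tId (loopCobr D d x y) (evalAt₂ (x + y) z w) := by
  have key : ∀ (t : FreeMod k V ⊗[k] FreeMod k V) (c : FreeMod k V),
      evalAt₃ x y z (TensorProduct.assoc k _ _ _ (t ⊗ₜ c))
        = TensorProduct.assoc k V V V (evalAt₂ x y t ⊗ₜ evalAt z c) := by
    intro t c
    induction t using TensorProduct.induction_on with
    | zero => simp
    | add u v hu hv => simp only [add_tmul, map_add, hu, hv]
    | tmul u v => simp [evalAt₃]
  induction w using TensorProduct.induction_on with
  | zero => simp
  | add u v hu hv => simp only [map_add, hu, hv]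
  | tmul u v => simp [tId, key, evalAt₂_cobracket]

/-- The cobracket attached to a Gel'fand–Dorfman coalgebra is a Lie conformal cobracket. -/
theorem IsGDCoalgebra.isLieConformalCoalgebra [CharZero k] {D d : V →ₗ[k] V ⊗[k] V}
    (h : IsGDCoalgebra D d) : IsLieConformalCoalgebra (cobracket D d) := by
  have hJ := (isGDAlgebra_iff_loopJacobi.1 h.dual).2
  refine ⟨fun u => ?_, fun u => ?_, fun u => ?_⟩
  · refine ext_evalAt₂ fun x y : k => ?_
    simp [evalAt₂_cobracket]
  · refine ext_evalAt₂ fun x y : k => ?_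
    have h1 := h.lie.skew (evalAt (x + y) u)
    have h2 : ∀ w : V ⊗[k] V, tau (tau w) = w := fun w => by simp [tau]
    rw [map_neg, evalAt₂_tau, evalAt₂_cobracket, evalAt₂_cobracket, add_comm y x, loopCobr_apply,
      loopCobr_apply, map_sub, map_add, map_smul, map_smul, h2]
    linear_combination (norm := module) h1
  · refine ext_evalAt₃ fun x y z : k => ext_pair₃ fun f g e => ?_
    have := DFunLike.congr_fun (hJ (-x) (-y) (-z) f g e) (evalAt (x + y + z) u)
    simp only [LinearMap.add_apply, ← neg_add, ← dualOp_loopCobr] at this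
    simp only [map_sub, evalAt₃_tau12, evalAt₃_idT, evalAt₃_tId, pair₃_tau12, pair₃_idT, pair₃_tId,
      evalAt₂_cobracket, ← dualOp_apply]
    rw [← add_assoc, ← add_assoc, add_comm y x]
    linear_combination this

end Dual

/-! ### Invariant forms -/

section Invariant

variable {k : Type*} [Field k] {V : Type*} [AddCommGroup V] [Module k V]
  {m br : V →ₗ[k] V →ₗ[k] V} {F : V →ₗ[k] V →ₗ[k] k}

/-- An invariant form of a Gel'fand–Dorfman algebra pairs the fibres of degrees `p` and `-p`
invariantly for the loop bracket. -/
theorem loopBr_invariant (symm : ∀ a b, F a b = F b a)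
    (hm : ∀ a b c, F (m a b) c = - F b (starOp m a c))
    (hb : ∀ a b c, F (br a b) c = F a (br b c)) {p q r : k} (h : p + q + r = 0) (a b c : V) :
    F (loopBr m br p q a b) c = F a (loopBr m br q r b c) := by
  obtain rfl : r = -p - q := by linear_combination h
  have hm' : ∀ a b c, F (m a b) c = - F (m a c) b - F (m c a) b := fun a b c => by
    rw [hm, starOp, LinearMap.add_apply, LinearMap.add_apply, map_add, LinearMap.flip_apply,
      symm b, symm b]
    ring
  rw [symm a, loopBr_apply, loopBr_apply]
  simp only [map_add, map_sub, map_smul, LinearMap.add_apply, LinearMap.sub_apply,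
    LinearMap.smul_apply, smul_eq_mul]
  rw [hb a b c, symm a]
  linear_combination q * hm' b a c - p * hm' a b c + p * hm' c b a

variable (m br F) in
/-- The four-linear form `⟨[u,v],[w,z]⟩ + ⟨[v,w],[u,z]⟩ - ⟨[u,w],[v,z]⟩` of the loop bracket, in
degrees `p`, `q`, `r`, `s`.  For an invariant form it is, up to sign, the pairing of the Jacobi
defect of `u`, `v`, `w` with `z`, and it is alternating in all four arguments. -/
noncomputable def jacobiForm (p q r s : k) (u v w z : V) : k :=
  F (loopBr m br p q u v) (loopBr m br r s w z) + F (loopBr m br q r v w) (loopBr m br p s u z)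
    - F (loopBr m br p r u w) (loopBr m br q s v z)

theorem form_jacobi_defect (halt : ∀ a, br a a = 0) (symm : ∀ a b, F a b = F b a)
    (hm : ∀ a b c, F (m a b) c = - F b (starOp m a c))
    (hb : ∀ a b c, F (br a b) c = F a (br b c)) {p q r s : k} (h : p + q + r + s = 0)
    (u v w z : V) :
    F (loopBr m br p (q + r) u (loopBr m br q r v w)
      - (loopBr m br (p + q) r (loopBr m br p q u v) w
        + loopBr m br q (p + r) v (loopBr m br p r u w))) z
      = - jacobiForm m br F p q r s u v w z := by
  rw [loopBr_swap halt p (q + r) u, loopBr_swap halt q (p + r) v, map_sub, map_add, map_neg,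
    map_neg,
    LinearMap.sub_apply, LinearMap.add_apply, LinearMap.neg_apply, LinearMap.neg_apply,
    loopBr_invariant (r := s) symm hm hb (by linear_combination h) (loopBr m br q r v w) u,
    loopBr_invariant (r := s) symm hm hb (by linear_combination h) (loopBr m br p q u v) w,
    loopBr_invariant (r := s) symm hm hb (by linear_combination h) (loopBr m br p r u w) v,
    jacobiForm]
  ring

theorem jacobiForm_swap₁₂ (halt : ∀ a, br a a = 0) (p q r s : k) (u v w z : V) :
    jacobiForm m br F p q r s u v w z = - jacobiForm m br F q p r s v u w z := by
  simp only [jacobiForm]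
  rw [loopBr_swap halt p q u v, map_neg, LinearMap.neg_apply]
  ring

theorem jacobiForm_swap₂₃ (halt : ∀ a, br a a = 0) (p q r s : k) (u v w z : V) :
    jacobiForm m br F p q r s u v w z = - jacobiForm m br F p r q s u w v z := by
  simp only [jacobiForm]
  rw [loopBr_swap halt q r v w, map_neg, LinearMap.neg_apply]
  ring

theorem jacobiForm_swap₃₄ (halt : ∀ a, br a a = 0) (symm : ∀ a b, F a b = F b a)
    (p q r s : k) (u v w z : V) :
    jacobiForm m br F p q r s u v w z = - jacobiForm m br F p q s r u v z w := by
  simp only [jacobiForm]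
  rw [loopBr_swap halt r s w z, map_neg, symm (loopBr m br q s v z), symm (loopBr m br p s u z)]
  ring

theorem loopJacobi_iff_jacobiForm (halt : ∀ a, br a a = 0) (symm : ∀ a b, F a b = F b a)
    (hm : ∀ a b c, F (m a b) c = - F b (starOp m a c))
    (hb : ∀ a b c, F (br a b) c = F a (br b c)) (hF : ∀ a, (∀ b, F a b = 0) → a = 0) :
    LoopJacobi m br ↔ ∀ p q r s : k, p + q + r + s = 0 → ∀ u v w z,
      jacobiForm m br F p q r s u v w z = 0 := by
  constructor
  · intro h p q r s hs u v w z
    rw [← neg_eq_zero, ← form_jacobi_defect halt symm hm hb hs, sub_eq_zero.2 (h p q r u v w),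
      map_zero, LinearMap.zero_apply]
  · intro h p q r u v w
    refine sub_eq_zero.1 (hF _ fun z => ?_)
    have hs : p + q + r + (-p - q - r) = 0 := by ring
    rw [form_jacobi_defect halt symm hm hb hs, h p q r _ hs, neg_zero]

end Invariant

/-! ### The double `A ⊕ A*` -/

section Double

variable {k : Type*} [Field k] {A : Type*} [AddCommGroup A] [Module k A]

@[simp] theorem doubleForm_apply (u v : A × Module.Dual k A) :
    doubleForm k A u v = u.2 v.1 + v.2 u.1 := rfl

theorem doubleForm_symm (u v : A × Module.Dual k A) :
    doubleForm k A u v = doubleForm k A v u := by simp [add_comm]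

theorem eq_zero_of_doubleForm (u : A × Module.Dual k A)
    (h : ∀ v, doubleForm k A u v = 0) : u = 0 := by
  refine Prod.ext ((Module.forall_dual_apply_eq_zero_iff k u.1).1 fun f => ?_)
    (LinearMap.ext fun a => ?_)
  · simpa using h (0, f)
  · simpa using h (a, 0)

theorem doubleForm_nondegenerate : (doubleForm k A).Nondegenerate :=
  ⟨fun u h => eq_zero_of_doubleForm u h,
    fun u h => eq_zero_of_doubleForm u fun v => by rw [doubleForm_symm, h]⟩

theorem prod_induction {A B : Type*} [AddCommGroup A] [AddCommGroup B] {P : A × B → Prop}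
    (hadd : ∀ u v, P u → P v → P (u + v)) (hA : ∀ a, P (a, 0)) (hB : ∀ f, P (0, f)) (u : A × B) :
    P u := by
  simpa using hadd _ _ (hA u.1) (hB u.2)

variable {M M' : (A × Module.Dual k A) →ₗ[k] (A × Module.Dual k A) →ₗ[k] (A × Module.Dual k A)}

/-- A product on `A ⊕ A*` that is invariant in the sense of quadratic Novikov algebras is
determined by its restrictions to `A` and to `A*`. -/
theorem eq_of_invariant_mul
    (hM : ∀ u v w, doubleForm k A (M u v) w = - doubleForm k A v (starOp M u w))
    (hM' : ∀ u v w, doubleForm k A (M' u v) w = - doubleForm k A v (starOp M' u w))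
    (hAA : ∀ a b, M (a, 0) (b, 0) = M' (a, 0) (b, 0))
    (hFF : ∀ f g, M (0, f) (0, g) = M' (0, f) (0, g)) : M = M' := by
  set N := M - M' with hN
  have e1 : ∀ u v w, doubleForm k A (N u v) w
      = - doubleForm k A (N u w) v - doubleForm k A (N w u) v := by
    intro u v w
    have h1 := hM u v w
    have h2 := hM' u v w
    simp only [starOp, LinearMap.add_apply, LinearMap.flip_apply, map_add] at h1 h2
    simp only [hN, LinearMap.sub_apply, map_sub, h1, h2, doubleForm_symm v]
    ring
  -- `e1` for `(u, v, w)` and for `(w, v, u)` have the same right-hand side.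
  have e2 : ∀ u v w, doubleForm k A (N u v) w = doubleForm k A (N w v) u := by
    intro u v w
    rw [e1 u v w, e1 w v u]
    ring
  have zA : ∀ a b, N (a, 0) (b, 0) = 0 := fun a b => by simp [hN, hAA]
  have zF : ∀ f g, N (0, f) (0, g) = 0 := fun f g => by simp [hN, hFF]
  have key : ∀ w u v, doubleForm k A (N u v) w = 0 := by
    intro w u v
    induction u using prod_induction with
    | hadd u u' hu hu' => simp only [map_add, LinearMap.add_apply, hu, hu', add_zero]
    | hA a =>
      induction v using prod_induction with
      | hadd v v' hv hv' => simp only [map_add, LinearMap.add_apply, hv, hv', add_zero]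
      | hA b => rw [zA, map_zero, LinearMap.zero_apply]
      | hB f =>
        induction w using prod_induction with
        | hadd v v' hv hv' => simp only [map_add, hv, hv', add_zero]
        | hA b => rw [e1, zA, zA]; simp
        | hB g => rw [e2, zF]; simp
    | hB f =>
      induction v using prod_induction with
      | hadd v v' hv hv' => simp only [map_add, LinearMap.add_apply, hv, hv', add_zero]
      | hB b => rw [zF, map_zero, LinearMap.zero_apply]
      | hA a =>
        induction w using prod_induction with
        | hadd v v' hv hv' => simp only [map_add, hv, hv', add_zero]
        | hA b => rw [e2, zA]; simp
        | hB g => rw [e1, zF, zF]; simp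
  rw [← sub_eq_zero, ← hN]
  exact LinearMap.ext fun u => LinearMap.ext fun v => eq_zero_of_doubleForm _ fun w => key w u v

/-- An invariant bracket on `A ⊕ A*` is determined by its restrictions to `A` and to `A*`. -/
theorem eq_of_invariant_br
    (hM : ∀ u v w, doubleForm k A (M u v) w = doubleForm k A u (M v w))
    (hM' : ∀ u v w, doubleForm k A (M' u v) w = doubleForm k A u (M' v w))
    (hAA : ∀ a b, M (a, 0) (b, 0) = M' (a, 0) (b, 0))
    (hFF : ∀ f g, M (0, f) (0, g) = M' (0, f) (0, g)) : M = M' := by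
  set N := M - M' with hN
  -- Among three arguments of type `A` or `A*`, two cyclically adjacent ones have the same type.
  have e1 : ∀ u v w, doubleForm k A (N u v) w = doubleForm k A (N v w) u := by
    intro u v w
    rw [doubleForm_symm _ u]
    simp only [hN, LinearMap.sub_apply, map_sub, hM, hM']
  have zA : ∀ a b, N (a, 0) (b, 0) = 0 := fun a b => by simp [hN, hAA]
  have zF : ∀ f g, N (0, f) (0, g) = 0 := fun f g => by simp [hN, hFF]
  have key : ∀ w u v, doubleForm k A (N u v) w = 0 := by
    intro w u v
    induction u using prod_induction with
    | hadd u u' hu hu' => simp only [map_add, LinearMap.add_apply, hu, hu', add_zero]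
    | hA a =>
      induction v using prod_induction with
      | hadd v v' hv hv' => simp only [map_add, LinearMap.add_apply, hv, hv', add_zero]
      | hA b => rw [zA, map_zero, LinearMap.zero_apply]
      | hB f =>
        induction w using prod_induction with
        | hadd v v' hv hv' => simp only [map_add, hv, hv', add_zero]
        | hA b => rw [e1, e1, zA]; simp
        | hB g => rw [e1, zF]; simp
    | hB f =>
      induction v using prod_induction with
      | hadd v v' hv hv' => simp only [map_add, LinearMap.add_apply, hv, hv', add_zero]
      | hB b => rw [zF, map_zero, LinearMap.zero_apply]
      | hA a =>
        induction w using prod_induction with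
        | hadd v v' hv hv' => simp only [map_add, hv, hv', add_zero]
        | hA b => rw [e1, zA]; simp
        | hB g => rw [e1, e1, zF]; simp
  rw [← sub_eq_zero, ← hN]
  exact LinearMap.ext fun u => LinearMap.ext fun v => eq_zero_of_doubleForm _ fun w => key w u v

@[simp] theorem dualRep_apply (φ : A →ₗ[k] A →ₗ[k] A) (a : A) (f : Module.Dual k A) (b : A) :
    dualRep φ a f b = - f (φ a b) := rfl

variable [FiniteDimensional k A]

@[simp] theorem apply_dualRep' (φ : Module.Dual k A →ₗ[k] Module.Dual k A →ₗ[k] Module.Dual k A)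
    (f : Module.Dual k A) (a : A) (g : Module.Dual k A) :
    g (dualRep' φ f a) = - φ f g a := by
  have h : g (dualRep' φ f a) = Module.evalEquiv k A
    ((Module.evalEquiv k A).symm (dualRep φ f (Module.evalEquiv k A a))) g := rfl
  rw [h, LinearEquiv.apply_symm_apply]
  rfl

variable (m br : A →ₗ[k] A →ₗ[k] A)
  (m' br' : Module.Dual k A →ₗ[k] Module.Dual k A →ₗ[k] Module.Dual k A)

theorem doubleMul_apply (u v : A × Module.Dual k A) : doubleMul m m' u v
    = (m u.1 v.1 + dualRep' (starOp m') u.2 v.1 - dualRep' m'.flip v.2 u.1,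
      m' u.2 v.2 + dualRep (starOp m) u.1 v.2 - dualRep m.flip v.1 u.2) := by
  simp [doubleMul, matchMul, sub_eq_add_neg]

theorem doubleBr_apply (u v : A × Module.Dual k A) : doubleBr br br' u v
    = (br u.1 v.1 + dualRep' br' u.2 v.1 - dualRep' br' v.2 u.1,
      br' u.2 v.2 + dualRep br u.1 v.2 - dualRep br v.1 u.2) := rfl

theorem doubleMul_invariant (u v w : A × Module.Dual k A) :
    doubleForm k A (doubleMul m m' u v) w
      = - doubleForm k A v (starOp (doubleMul m m') u w) := by
  simp [doubleMul_apply, starOp]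
  ring

variable {br br'}

theorem doubleBr_invariant (h : ∀ a, br a a = 0) (h' : ∀ f, br' f f = 0)
    (u v w : A × Module.Dual k A) :
    doubleForm k A (doubleBr br br' u v) w = doubleForm k A u (doubleBr br br' v w) := by
  simp only [doubleBr_apply, doubleForm_apply, map_add, map_sub, LinearMap.add_apply,
    LinearMap.sub_apply, dualRep_apply, apply_dualRep']
  rw [br_swap h v.1 u.1, br_swap h' w.2 u.2, br_swap h w.1 u.1, br_swap h' v.2 u.2]
  simp only [map_neg, LinearMap.neg_apply]
  ring

theorem doubleBr_alternating (h : ∀ a, br a a = 0) (h' : ∀ f, br' f f = 0)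
    (u : A × Module.Dual k A) : doubleBr br br' u u = 0 := by
  rw [doubleBr_apply, h, h']
  simp

variable {m m'}

/-- The data of a matched pair `(A, A*)` with the coadjoint actions is a Manin triple as soon as the
double is a Gel'fand–Dorfman algebra. -/
theorem isManinTripleGD_double (hA : IsGDAlgebra m br) (hA' : IsGDAlgebra m' br')
    (h : IsGDAlgebra (doubleMul m m') (doubleBr br br')) :
    IsManinTripleGD (doubleMul m m') (doubleBr br br') m br m' br' where
  left := hA
  right := hA'
  mul_left a b := by simp [doubleMul_apply]
  br_left a b := by simp [doubleBr_apply]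
  mul_right a b := by simp [doubleMul_apply]
  br_right a b := by simp [doubleBr_apply]
  quadratic := ⟨h, doubleForm_nondegenerate, doubleForm_symm, doubleMul_invariant m m',
    doubleBr_invariant hA.lie.alternating hA'.lie.alternating⟩

/-- The operations of a standard Manin triple are those of the double. -/
theorem IsManinTripleGD.eq_double {M B : (A × Module.Dual k A) →ₗ[k] (A × Module.Dual k A) →ₗ[k]
    (A × Module.Dual k A)} (h : IsManinTripleGD M B m br m' br') :
    M = doubleMul m m' ∧ B = doubleBr br br' := by
  refine ⟨eq_of_invariant_mul h.quadratic.invariant_mul (doubleMul_invariant m m')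
      (fun a b => ?_) (fun f g => ?_),
    eq_of_invariant_br h.quadratic.invariant_br
      (doubleBr_invariant h.left.lie.alternating h.right.lie.alternating)
      (fun a b => ?_) (fun f g => ?_)⟩
  · rw [h.mul_left]; simp [doubleMul_apply]
  · rw [h.mul_right]; simp [doubleMul_apply]
  · rw [h.br_left]; simp [doubleBr_apply]
  · rw [h.br_right]; simp [doubleBr_apply]

variable (m br m' br')

/-- The loop bracket of the double. -/
noncomputable abbrev doubleLoop (p q : k) :
    (A × Module.Dual k A) →ₗ[k] (A × Module.Dual k A) →ₗ[k] (A × Module.Dual k A) :=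
  loopBr (doubleMul m m') (doubleBr br br') p q

theorem doubleLoop_left (p q : k) (a b : A) :
    doubleLoop m br m' br' p q (a, 0) (b, 0) = (loopBr m br p q a b, 0) := by
  simp [doubleLoop, loopBr_apply, doubleMul_apply, doubleBr_apply]

theorem doubleLoop_right (p q : k) (f g : Module.Dual k A) :
    doubleLoop m br m' br' p q (0, f) (0, g) = (0, loopBr m' br' p q f g) := by
  simp [doubleLoop, loopBr_apply, doubleMul_apply, doubleBr_apply]

variable {m br m' br'}

/-- The `A`-component of the bracket of the double: `A*` acts on `A` by the coadjoint action. -/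
theorem apply_doubleLoop_fst (p q : k) (u v : A × Module.Dual k A)
    (g : Module.Dual k A) :
    g (doubleLoop m br m' br' p q u v).1 = g (loopBr m br p q u.1 v.1)
      - loopBr m' br' p (-p - q) u.2 g v.1 + loopBr m' br' q (-p - q) v.2 g u.1 := by
  simp [doubleLoop, loopBr_apply, doubleMul_apply, doubleBr_apply, starOp]
  ring

/-- The `A*`-component of the bracket of the double: `A` acts on `A*` by the coadjoint action. -/
theorem doubleLoop_snd_apply (p q : k) (u v : A × Module.Dual k A) (c : A) :
    (doubleLoop m br m' br' p q u v).2 c = loopBr m' br' p q u.2 v.2 c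
      - v.2 (loopBr m br p (-p - q) u.1 c) + u.2 (loopBr m br q (-p - q) v.1 c) := by
  simp [doubleLoop, loopBr_apply, doubleMul_apply, doubleBr_apply, starOp]
  ring

end Double

/-! ### The cocycle condition -/

section Cocycle

variable {k : Type*} [Field k] {V : Type*} [AddCommGroup V] [Module k V]

@[simp] theorem onL_add (f g : V →ₗ[k] V) (w : V ⊗[k] V) : onL (f + g) w = onL f w + onL g w := by
  simp [onL, TensorProduct.map_add_left]

@[simp] theorem onR_add (f g : V →ₗ[k] V) (w : V ⊗[k] V) : onR (f + g) w = onR f w + onR g w := by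
  simp [onR, TensorProduct.map_add_right]

@[simp] theorem onL_smul (c : k) (f : V →ₗ[k] V) (w : V ⊗[k] V) : onL (c • f) w = c • onL f w := by
  simp [onL, TensorProduct.map_smul_left]

@[simp] theorem onR_smul (c : k) (f : V →ₗ[k] V) (w : V ⊗[k] V) : onR (c • f) w = c • onR f w := by
  simp [onR, TensorProduct.map_smul_right]

@[simp] theorem onL_sub (f g : V →ₗ[k] V) (w : V ⊗[k] V) : onL (f - g) w = onL f w - onL g w := by
  rw [eq_sub_iff_add_eq, ← onL_add, sub_add_cancel]

@[simp] theorem onR_sub (f g : V →ₗ[k] V) (w : V ⊗[k] V) : onR (f - g) w = onR f w - onR g w := by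
  rw [eq_sub_iff_add_eq, ← onR_add, sub_add_cancel]

@[simp] theorem tau_tau (w : V ⊗[k] V) : tau (tau w) = w := by simp [tau]

@[simp] theorem tau_onL (f : V →ₗ[k] V) (w : V ⊗[k] V) : tau (onL f w) = onR f (tau w) :=
  (TensorProduct.map_comm _ _ w).symm

@[simp] theorem tau_onR (f : V →ₗ[k] V) (w : V ⊗[k] V) : tau (onR f w) = onL f (tau w) :=
  (TensorProduct.map_comm _ _ w).symm

variable (m br : V →ₗ[k] V →ₗ[k] V) (D d : V →ₗ[k] V ⊗[k] V)

/-- The value at scalars of `a_λ δ(b)`: the action of `a`, in degree `p`, on the value of the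
cobracket of `b`, with the two tensor factors of the result in degrees `x` and `y`. -/
noncomputable def loopAct (p x y : k) (a b : V) : V ⊗[k] V :=
  onL (loopBr m br p (x - p) a) (loopCobr D d (x - p) y b)
    + onR (loopBr m br p (y - p) a) (loopCobr D d x (y - p) b)

/-- The cocycle condition of a Lie bialgebra for the loop bracket and the values of the
cobracket, in all degrees. -/
def LoopCocycle : Prop :=
  ∀ (p x y : k) (a b : V), loopCobr D d x y (loopBr m br p (x + y - p) a b)
    = loopAct m br D d p x y a b - loopAct m br D d (x + y - p) x y b a

variable {m br D d}

theorem loopBr_sub (p x : k) (a : V) :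
    loopBr m br p (x - p) a = x • m.flip a - p • starOp m a + br a := by
  ext b
  simp only [loopBr_apply, starOp, LinearMap.add_apply, LinearMap.sub_apply, LinearMap.smul_apply,
    LinearMap.flip_apply]
  module

/-- The defect of the cocycle condition is a quadratic polynomial in the degrees, and its
coefficients are the defects of the compatibilities of a Gel'fand–Dorfman bialgebra and of their
images under the flip. -/
theorem loopCocycle_defect (p x y : k) (a b : V) :
    loopCobr D d x y (loopBr m br p (x + y - p) a b)
      - (loopAct m br D d p x y a b - loopAct m br D d (x + y - p) x y b a)
    = (d (br a b) - onL (br a) (d b) - onR (br a) (d b) + onL (br b) (d a) + onR (br b) (d a))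
      + p • (-d (m b a) - d (m a b) + onL (starOp m a) (d b) + onL (br a) (D b)
          + onR (starOp m a) (d b) - onR (br a) (tau (D b)) + onL (starOp m b) (d a)
          + onL (br b) (D a) + onR (starOp m b) (d a) - onR (br b) (tau (D a)))
      + x • (d (m b a) + D (br a b) - onL (m.flip a) (d b) - onL (br a) (D b) - onR (br a) (D b)
          + onL (m.flip b) (d a) - onL (starOp m b) (d a) - onR (starOp m b) (d a)
          + onR (br b) (D a) + onR (br b) (tau (D a)))
      + y • (d (m b a) - tau (D (br a b)) + onL (br a) (tau (D b)) - onR (m.flip a) (d b)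
          + onR (br a) (tau (D b)) - onL (starOp m b) (d a) - onL (br b) (D a)
          - onL (br b) (tau (D a)) + onR (m.flip b) (d a) - onR (starOp m b) (d a))
      + (p * p) • (-onL (starOp m a) (D b) + onR (starOp m a) (tau (D b)) + onL (starOp m b) (D a)
          - onR (starOp m b) (tau (D a)))
      + (x * x) • (D (m b a) - onL (m.flip a) (D b) - onR (starOp m b) (D a)
          - onR (starOp m b) (tau (D a)))
      + (y * y) • (-tau (D (m b a)) + onR (m.flip a) (tau (D b)) + onL (starOp m b) (D a)
          + onL (starOp m b) (tau (D a)))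
      + (p * x) • (-D (m b a) - D (m a b) + onL (m.flip a) (D b) + onL (starOp m a) (D b)
          + onR (starOp m a) (D b) + onL (m.flip b) (D a) - onL (starOp m b) (D a)
          + onR (starOp m b) (D a) + onR (starOp m b) (tau (D a)) + onR (starOp m b) (tau (D a)))
      + (p * y) • (tau (D (m b a)) + tau (D (m a b)) - onL (starOp m a) (tau (D b))
          - onR (m.flip a) (tau (D b)) - onR (starOp m a) (tau (D b)) - onL (starOp m b) (D a)
          - onL (starOp m b) (D a) - onL (starOp m b) (tau (D a)) - onR (m.flip b) (tau (D a))
          + onR (starOp m b) (tau (D a)))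
      + (x * y) • (D (m b a) - tau (D (m b a)) + onL (m.flip a) (tau (D b)) - onR (m.flip a) (D b)
          - onL (m.flip b) (D a) - onL (m.flip b) (tau (D a)) + onL (starOp m b) (D a)
          + onL (starOp m b) (tau (D a)) + onR (m.flip b) (D a) + onR (m.flip b) (tau (D a))
          - onR (starOp m b) (D a) - onR (starOp m b) (tau (D a))) := by
  rw [loopBr_apply m br p (x + y - p)]
  simp only [loopAct, loopBr_sub, onL_add, onL_sub, onL_smul, onR_add, onR_sub, onR_smul,
    loopCobr_apply, map_add, map_sub, map_smul]
  module

/-- The loop cocycle condition comprises the compatibilities of a Gel'fand–Dorfman bialgebra. -/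
theorem isGDBialgebra_iff_loopCocycle [CharZero k] (hA : IsGDAlgebra m br)
    (hD : IsGDCoalgebra D d) : IsGDBialgebra m br D d ↔ LoopCocycle m br D d := by
  have sk := br_swap hA.lie.alternating
  have td : ∀ a, tau (d a) = - d a := fun a => by
    have h := hD.lie.skew a
    linear_combination (norm := module) h
  have hL : ∀ a w, onL (m a) w = onL (starOp m a) w - onL (m.flip a) w := fun a w => by
    rw [← onL_sub, starOp, LinearMap.add_apply, add_sub_cancel_right]
  constructor
  · intro h p x y a b
    rw [← sub_eq_zero, loopCocycle_defect]
    have e0 := h.lie.cocycle a b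
    have ec := h.compat a b
    have ec' := h.compat b a
    have e1 := h.novikov.compat₁ a b
    have e1' := h.novikov.compat₁ b a
    have e2 := h.novikov.compat₂ a b
    have e3 := h.novikov.compat₃ a b
    rw [sk b a] at ec'
    simp only [map_add, map_neg, hL] at e0 ec ec' e1 e1' e2 e3
    have tc := congrArg tau ec
    have t1 := congrArg tau e1
    have t1' := congrArg tau e1'
    simp only [map_add, map_sub, map_neg, tau_onL, tau_onR, tau_tau, td] at tc t1 t1'
    linear_combination (norm := module) e0 - p • (ec + ec') + x • ec - y • tc - (p * p) • e2
      + (x * x) • e1' - (y * y) • t1' - (p * x) • (e1 + e1' - e2) + (p * y) • (t1 + t1' + e2)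
      + (x * y) • (e1' - t1' - e3)
  · intro h
    have key := fun a b => quadratic_coeff_eq_zero (k := k) (M := V ⊗[k] V) fun p x y => by
      rw [← loopCocycle_defect p x y a b]
      exact sub_eq_zero.2 (h p x y a b)
    have e1 : ∀ a b, D (m a b)
        = onL (m.flip b) (D a) + onR (starOp m a) (D b + tau (D b)) := fun a b => by
      have := (key b a).2.2.1.2.1
      rw [map_add]
      linear_combination (norm := module) this
    refine ⟨hA, hD, ⟨hA.novikov, hD.novikov, e1, fun a b => ?_, fun a b => ?_⟩,
      ⟨hA.lie, hD.lie, fun a b => ?_⟩, fun a b => ?_⟩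
    · have := (key a b).2.2.1.1
      linear_combination (norm := module) -this
    · have h1 := e1 b a
      have t1 := congrArg tau h1
      have := (key a b).2.2.2.2.2
      simp only [map_add, tau_onL, tau_onR, tau_tau] at h1 t1 ⊢
      linear_combination (norm := module) h1 - t1 - this
    · have := (key a b).1
      linear_combination (norm := module) this
    · have := (key a b).2.1.2.1
      rw [hL, map_add]
      linear_combination (norm := module) this

theorem evalAt₂_ev_tensorAct (l x y : k) (u : FreeMod k V) (w : FreeMod k V ⊗[k] FreeMod k V) :
    evalAt₂ x y (ev l (tensorAct (gdBracket m br) u w))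
      = onL (loopBr m br (-l) (l + x) (evalAt (-l) u)) (evalAt₂ (l + x) y w)
        + onR (loopBr m br (-l) (l + y) (evalAt (-l) u)) (evalAt₂ x (l + y) w) := by
  induction w using TensorProduct.induction_on with
  | zero => simp
  | add v w hv hw => simp only [map_add, hv, hw]; abel
  | tmul v w =>
    have h : tensorAct (gdBracket m br) u (v ⊗ₜ w)
        = mapLam ((TensorProduct.mk k _ _).flip w) (gdBracket m br u v)
          + mapLam (TensorProduct.mk k _ _ v) (gdBracket m br u w) := rfl
    simp [h, ev_mapLam, evalAt_ev_gdBracket, onL, onR]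

theorem evalAt₂_tensorAct_cobracket (l x y : k) (u v : FreeMod k V) :
    evalAt₂ x y (ev l (tensorAct (gdBracket m br) u (cobracket D d v)))
      = loopAct m br D d (-l) x y (evalAt (-l) u) (evalAt (l + x + y) v) := by
  rw [evalAt₂_ev_tensorAct, evalAt₂_cobracket, evalAt₂_cobracket, loopAct, sub_neg_eq_add,
    sub_neg_eq_add, add_comm x l, add_comm y l, add_assoc l x y, add_left_comm x l y]

/-- `k[∂]V` is a Lie conformal bialgebra if and only if the loop cocycle condition holds. -/
theorem isLieConformalBialgebra_iff_loopCocycle [CharZero k] (hA : IsGDAlgebra m br)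
    (hD : IsGDCoalgebra D d) :
    IsLieConformalBialgebra (gdBracket m br) (cobracket D d) ↔ LoopCocycle m br D d := by
  have hs : ∀ (l x y : k) (u v : FreeMod k V),
      evalAt₂ x y (subst (-(l • 1) - del2 k (FreeMod k V))
        (tensorAct (gdBracket m br) v (cobracket D d u)))
      = loopAct m br D d (x + y + l) x y (evalAt (x + y + l) v) (evalAt (-l) u) := by
    intro l x y u v
    rw [map_subst_of_intertwine (t := -l - (x + y)) (fun v => by simp [sub_smul, add_smul]),
      evalAt₂_tensorAct_cobracket]
    congr 2 <;> ring_nf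
  constructor
  · intro h p x y a b
    have := congrArg (evalAt₂ x y) (h.cocycle (incl k V a) (incl k V b) (-p))
    rw [map_sub, evalAt₂_tensorAct_cobracket, hs, evalAt₂_cobracket, evalAt_ev_gdBracket] at this
    simp only [evalAt_incl, neg_neg] at this
    rw [← sub_eq_add_neg] at this
    rw [this]
    congr 2
    ring_nf
  · intro h
    refine ⟨isLieConformal_gdBracket_iff.2 hA, hD.isLieConformalCoalgebra, fun u v l => ?_⟩
    refine ext_evalAt₂ fun x y : k => ?_
    have := h (-l) x y (evalAt (-l) u) (evalAt (x + y + l) v)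
    rw [sub_neg_eq_add] at this
    rw [map_sub, evalAt₂_tensorAct_cobracket, hs, evalAt₂_cobracket, evalAt_ev_gdBracket,
      add_assoc l x y, add_comm l (x + y), this]

end Cocycle

section DoubleCocycle

variable {k : Type*} [Field k] {A : Type*} [AddCommGroup A] [Module k A]
  [FiniteDimensional k A] {m br : A →ₗ[k] A →ₗ[k] A} {D d : A →ₗ[k] A ⊗[k] A}

/-- The part of the Jacobi identity of the double with two arguments in `A` and two in `A*` is
the cocycle condition. -/
theorem jacobiForm_double (h' : ∀ f, dualOp d f f = 0) (p x y : k) (a b : A)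
    (f g : Module.Dual k A) :
    jacobiForm (doubleMul m (dualOp D)) (doubleBr br (dualOp d)) (doubleForm k A)
      p (x + y - p) (-x) (-y) (a, 0) (b, 0) (0, f) (0, g)
    = pair₂ f g (loopCobr D d x y (loopBr m br p (x + y - p) a b)
      - (loopAct m br D d p x y a b - loopAct m br D d (x + y - p) x y b a)) := by
  set q := x + y - p with hq
  have hsw := loopBr_swap (k := k) (m := dualOp D) h'
  -- `⟨[b,f],[a,g]⟩` is the sum of two terms of the coadjoint actions.
  have key : ∀ (p s q r : k) (a b : A) (f g : Module.Dual k A),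
      (doubleLoop m br (dualOp D) (dualOp d) q r (b, 0) (0, f)).2
        (doubleLoop m br (dualOp D) (dualOp d) p s (a, 0) (0, g)).1
      = loopBr (dualOp D) (dualOp d) (-p - s) s (f ∘ₗ loopBr m br q (-q - r) b) g a := by
    intro p s q r a b f g
    have : (doubleLoop m br (dualOp D) (dualOp d) q r (b, 0) (0, f)).2
        = - (f ∘ₗ loopBr m br q (-q - r) b) :=
      LinearMap.ext fun c => by rw [doubleLoop_snd_apply]; simp
    rw [apply_doubleLoop_fst, this, hsw s]
    simp
  rw [jacobiForm, doubleLoop_left, doubleLoop_right]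
  simp only [doubleForm_apply, key, map_sub, map_add, loopAct, pair₂_loopCobr, pair₂_onL, pair₂_onR,
    map_zero, zero_add]
  rw [show -p - -x = x - p by ring, show -p - -y = y - p by ring, show -q - -x = x - q by ring,
    show -q - -y = y - q by ring, show -(x - p) = y - q by rw [hq]; ring,
    show -(y - p) = x - q by rw [hq]; ring, show -(x - q) = y - p by rw [hq]; ring,
    show -(y - q) = x - p by rw [hq]; ring, hsw (x - q) (-x), hsw (x - p) (-x)]
  simp only [LinearMap.neg_apply]
  ring

/-- The double is a Gel'fand–Dorfman algebra if and only if the cocycle condition holds. -/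
theorem isGDAlgebra_double_iff_loopCocycle [CharZero k] (hA : IsGDAlgebra m br)
    (hD : IsGDCoalgebra D d) :
    IsGDAlgebra (doubleMul m (dualOp D)) (doubleBr br (dualOp d)) ↔ LoopCocycle m br D d := by
  have hA' := hD.dual
  have h0 := hA.lie.alternating
  have h0' := hA'.lie.alternating
  have halt := doubleBr_alternating h0 h0'
  have hm := doubleMul_invariant m (dualOp D)
  have hb := doubleBr_invariant h0 h0'
  rw [isGDAlgebra_iff_loopJacobi, and_iff_right halt,
    loopJacobi_iff_jacobiForm halt doubleForm_symm hm hb eq_zero_of_doubleForm]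
  constructor
  · intro h p x y a b
    refine sub_eq_zero.1 (ext_pair₂ fun f g => ?_)
    rw [← jacobiForm_double h0', h _ _ _ _ (by ring), map_zero]
  · intro h
    set J := jacobiForm (doubleMul m (dualOp D)) (doubleBr br (dualOp d)) (doubleForm k A) with hJ
    have s12 : ∀ {p q r s u v w z}, J q p r s v u w z = 0 → J p q r s u v w z = 0 :=
      fun h => by rw [hJ, jacobiForm_swap₁₂ halt, ← hJ, h, neg_zero]
    have s23 : ∀ {p q r s u v w z}, J p r q s u w v z = 0 → J p q r s u v w z = 0 :=
      fun h => by rw [hJ, jacobiForm_swap₂₃ halt, ← hJ, h, neg_zero]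
    have s34 : ∀ {p q r s u v w z}, J p q s r u v z w = 0 → J p q r s u v w z = 0 :=
      fun h => by rw [hJ, jacobiForm_swap₃₄ halt doubleForm_symm, ← hJ, h, neg_zero]
    -- By the symmetries it is enough to know additivity in one slot, and the types
    -- `(A, A, A, ·)`, `(A*, A*, A*, ·)` and `(A, A, A*, A*)`.
    have add₄ : ∀ {p q r s u v w} z z', J p q r s u v w z = 0 → J p q r s u v w z' = 0 →
        J p q r s u v w (z + z') = 0 := by
      intro p q r s u v w z z' h1 h2
      have : J p q r s u v w (z + z') = J p q r s u v w z + J p q r s u v w z' := by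
        simp only [hJ, jacobiForm, map_add]
        ring
      rw [this, h1, h2, add_zero]
    have add₃ : ∀ {p q r s u v z} w w', J p q r s u v w z = 0 → J p q r s u v w' z = 0 →
        J p q r s u v (w + w') z = 0 := fun w w' h1 h2 => s34 (add₄ _ _ (s34 h1) (s34 h2))
    have add₂ : ∀ {p q r s u w z} v v', J p q r s u v w z = 0 → J p q r s u v' w z = 0 →
        J p q r s u (v + v') w z = 0 := fun w w' h1 h2 => s23 (add₃ _ _ (s23 h1) (s23 h2))
    have add₁ : ∀ {p q r s v w z} u u', J p q r s u v w z = 0 → J p q r s u' v w z = 0 →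
        J p q r s (u + u') v w z = 0 := fun w w' h1 h2 => s12 (add₂ _ _ (s12 h1) (s12 h2))
    have hAAA : ∀ p q r s : k, p + q + r + s = 0 → ∀ a b c z,
        J p q r s (a, 0) (b, 0) (c, 0) z = 0 := by
      intro p q r s hs a b c z
      rw [← neg_eq_zero, hJ, ← form_jacobi_defect halt doubleForm_symm hm hb hs]
      simp only [doubleLoop_left]
      rw [(isGDAlgebra_iff_loopJacobi.1 hA).2]
      simp
    have hFFF : ∀ p q r s : k, p + q + r + s = 0 → ∀ f g e z,
        J p q r s (0, f) (0, g) (0, e) z = 0 := by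
      intro p q r s hs f g e z
      rw [← neg_eq_zero, hJ, ← form_jacobi_defect halt doubleForm_symm hm hb hs]
      simp only [doubleLoop_right]
      rw [(isGDAlgebra_iff_loopJacobi.1 hA').2]
      simp
    have hAAF : ∀ p q r s : k, p + q + r + s = 0 → ∀ a b f g,
        J p q r s (a, 0) (b, 0) (0, f) (0, g) = 0 := by
      intro p q r s hs a b f g
      obtain ⟨x, rfl⟩ : ∃ x, r = -x := ⟨-r, (neg_neg r).symm⟩
      obtain ⟨y, rfl⟩ : ∃ y, s = -y := ⟨-s, (neg_neg s).symm⟩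
      obtain rfl : q = x + y - p := by linear_combination hs
      rw [hJ, jacobiForm_double h0', sub_eq_zero.2 (h p x y a b), map_zero]
    have hAA : ∀ p q r s : k, p + q + r + s = 0 → ∀ a b w z,
        J p q r s (a, 0) (b, 0) w z = 0 := by
      intro p q r s hs a b w z
      refine prod_induction add₃ (fun c => hAAA _ _ _ _ hs _ _ _ _) (fun f => ?_) w
      exact prod_induction add₄ (fun c => s34 (hAAA _ _ _ _ (by linear_combination hs) _ _ _ _))
        (fun g => hAAF _ _ _ _ hs _ _ _ _) z
    have hFF : ∀ p q r s : k, p + q + r + s = 0 → ∀ f g w z,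
        J p q r s (0, f) (0, g) w z = 0 := by
      intro p q r s hs f g w z
      refine prod_induction add₃ (fun c => ?_) (fun e => hFFF _ _ _ _ hs _ _ _ _) w
      exact prod_induction add₄
        (fun b => s23 (s12 (s34 (s23 (hAAF _ _ _ _ (by linear_combination hs) _ _ _ _)))))
        (fun g => s34 (hFFF _ _ _ _ (by linear_combination hs) _ _ _ _)) z
    have hAF : ∀ p q r s : k, p + q + r + s = 0 → ∀ a f w z,
        J p q r s (a, 0) (0, f) w z = 0 := by
      intro p q r s hs a f w z
      exact prod_induction add₃
        (fun c => s23 (hAA _ _ _ _ (by linear_combination hs) _ _ _ _))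
        (fun e => s12 (s23 (hFF _ _ _ _ (by linear_combination hs) _ _ _ _))) w
    intro p q r s hs u v w z
    refine prod_induction add₁ (fun a => ?_) (fun f => ?_) u
    · exact prod_induction add₂ (fun b => hAA _ _ _ _ hs _ _ _ _)
        (fun g => hAF _ _ _ _ hs _ _ _ _) v
    · exact prod_induction add₂ (fun b => s12 (hAF _ _ _ _ (by linear_combination hs) _ _ _ _))
        (fun g => hFF _ _ _ _ hs _ _ _ _) v

end DoubleCocycle

/-! ### Conformal Manin triples -/

section ConformalForm

variable {k : Type*} [Field k] {V : Type*} [AddCommGroup V] [Module k V]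

@[simp] theorem eval_twist (l : k) (p : k[X]) : (twist k p).eval l = p.eval (-l) := by
  rw [twist, ← Polynomial.comp_eq_aeval, Polynomial.eval_comp, eval_neg, eval_X]

theorem eval_confForm (F : V →ₗ[k] V →ₗ[k] k) (l : k) (u v : FreeMod k V) :
    (confForm F u v).eval l = F (evalAt (-l) u) (evalAt l v) := by
  induction u using TensorProduct.induction_on with
  | zero => simp
  | add u u' hu hu' => simp only [map_add, LinearMap.add_apply, eval_add, hu, hu']
  | tmul p a =>
  induction v using TensorProduct.induction_on with
  | zero => simp
  | add v v' hv hv' => simp only [map_add, eval_add, hv, hv']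
  | tmul q b =>
    have h : confForm F (p ⊗ₜ a) (q ⊗ₜ b) = twist k p * q * C (F a b) := rfl
    simp only [h, eval_mul, eval_twist, eval_C, evalAt_tmul, map_smul, LinearMap.smul_apply,
      smul_eq_mul]
    ring

theorem eval_dualIso [FiniteDimensional k V] (n : k) (G : FreeMod k (Module.Dual k V))
    (u : FreeMod k V) :
    ((dualIso k V G).app u).eval n = evalAt (-n) G (evalAt n u) := by
  have h : ∀ G u, (dualIso k V G).app u = dualIsoAux k V G u := fun _ _ => rfl
  rw [h]
  induction G using TensorProduct.induction_on with
  | zero => simp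
  | add u u' hu hu' => simp only [map_add, LinearMap.add_apply, eval_add, hu, hu']
  | tmul p a =>
  induction u using TensorProduct.induction_on with
  | zero => simp
  | add v v' hv hv' => simp only [map_add, eval_add, hv, hv']
  | tmul q b =>
    simp only [dualIsoAux_tmul, eval_mul, eval_twist, eval_C, evalAt_tmul, map_smul,
      LinearMap.smul_apply, smul_eq_mul]
    ring

/-- Invariance of a conformal form is invariance under cyclic permutations. -/
theorem IsInvariantConformalForm.cyclic {P : Type*} [AddCommGroup P] [Module k P] [Module k[X] P]
    [IsScalarTower k k[X] P] {b : P →ₗ[k] P →ₗ[k] LamPoly P} {F : P →ₗ[k] P →ₗ[k] k[X]}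
    (h : IsInvariantConformalForm b F) (u v w : P) (l n : k) :
    (F (ev n (b u v)) w).eval l = (F (ev (l - n) (b v w)) u).eval (-n) := by
  have hφ : ∀ z, (Polynomial.leval n ∘ₗ F u) ((l • 1 - del k P : Module.End k P) z)
      = (l - n) • (Polynomial.leval n ∘ₗ F u) z := fun z => by
    simp [h.del_right, sub_mul, Polynomial.leval_apply]
  have := map_subst_of_intertwine hφ (b v w)
  simp only [LinearMap.comp_apply, Polynomial.leval_apply] at this
  rw [h.invariant, this, h.symm]

end ConformalForm

section ConformalDouble

variable {k : Type*} [Field k] {A : Type*} [AddCommGroup A] [Module k A]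

@[simp] theorem evalAt_inA (x : k) (u : FreeMod k A) : evalAt x (inA k A u) = (evalAt x u, 0) :=
  evalAt_baseChange _ x u

@[simp] theorem evalAt_inDual (x : k) (u : FreeMod k (Module.Dual k A)) :
    evalAt x (inDual k A u) = (0, evalAt x u) :=
  evalAt_baseChange _ x u

variable [CharZero k]

theorem inA_coprod_inDual_bijective : Function.Bijective ((inA k A).coprod (inDual k A)) := by
  constructor
  · rw [← LinearMap.ker_eq_bot, LinearMap.ker_eq_bot']
    rintro ⟨u, f⟩ h
    have h' : ∀ x : k, evalAt x u = 0 ∧ evalAt x f = 0 := fun x => by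
      simpa using congrArg (evalAt x) h
    exact Prod.ext (eq_zero_of_evalAt fun x => (h' x).1) (eq_zero_of_evalAt fun x => (h' x).2)
  · intro v
    refine ⟨((LinearMap.fst k A (Module.Dual k A)).baseChange k[X] v,
      (LinearMap.snd k A (Module.Dual k A)).baseChange k[X] v), ?_⟩
    refine FreeMod.ext_evalAt fun x : k => ?_
    simp

theorem freeMod_prod_induction {P : FreeMod k (A × Module.Dual k A) → Prop}
    (hadd : ∀ u v, P u → P v → P (u + v)) (hA : ∀ a, P (inA k A a)) (hF : ∀ f, P (inDual k A f))
    (u : FreeMod k (A × Module.Dual k A)) : P u := by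
  obtain ⟨⟨a, f⟩, rfl⟩ := inA_coprod_inDual_bijective.2 u
  exact hadd _ _ (hA a) (hF f)

theorem eq_zero_of_confForm (u : FreeMod k (A × Module.Dual k A))
    (h : ∀ v, confForm (doubleForm k A) u v = 0) : u = 0 := by
  refine eq_zero_of_evalAt fun x : k => eq_zero_of_doubleForm _ fun w => ?_
  have := congrArg (Polynomial.eval (-x)) (h (incl k _ w))
  rwa [eval_confForm, neg_neg, evalAt_incl, eval_zero] at this

/-- A `k`-linear cobracket of `k[∂]A` is `cobracket D d` if and only if it is dual to the
`λ`-bracket of `k[∂]A*`. -/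
theorem eq_cobracket_iff {D d : A →ₗ[k] A ⊗[k] A}
    {δ : FreeMod k A →ₗ[k] FreeMod k A ⊗[k] FreeMod k A} :
    δ = cobracket D d ↔ ∀ (f g : FreeMod k (Module.Dual k A)) (a : FreeMod k A) (l n : k),
      evalAt (-l) (ev n (gdBracket (dualOp D) (dualOp d) f g)) (evalAt l a)
        = pair₂ (evalAt (-n) f) (evalAt (n - l) g) (evalAt₂ n (l - n) (δ a)) := by
  have hc : ∀ (f g : FreeMod k (Module.Dual k A)) (a : FreeMod k A) (l n : k),
      evalAt (-l) (ev n (gdBracket (dualOp D) (dualOp d) f g)) (evalAt l a)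
        = pair₂ (evalAt (-n) f) (evalAt (n - l) g) (evalAt₂ n (l - n) (cobracket D d a)) := by
    intro f g a l n
    rw [evalAt_ev_gdBracket, evalAt₂_cobracket, pair₂_loopCobr, add_sub_cancel, neg_sub,
      ← sub_eq_add_neg]
  constructor
  · rintro rfl
    exact hc
  · intro h
    refine LinearMap.ext fun a => ext_evalAt₂ fun x y : k => ext_pair₂ fun f g => ?_
    have h1 := h (incl k _ f) (incl k _ g) a (x + y) x
    rw [hc] at h1
    simpa using h1.symm

variable [FiniteDimensional k A] {m br : A →ₗ[k] A →ₗ[k] A}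
  {m' br' : Module.Dual k A →ₗ[k] Module.Dual k A →ₗ[k] Module.Dual k A}

theorem gdBracket_double_inA (m br m' br') (a b : FreeMod k A) :
    gdBracket (doubleMul m m') (doubleBr br br') (inA k A a) (inA k A b)
      = mapLam ((inA k A).restrictScalars k) (gdBracket m br a b) := by
  refine FreeMod.ext_ev_evalAt fun l x : k => ?_
  simp [ev_mapLam, evalAt_ev_gdBracket, doubleLoop_left]

theorem gdBracket_double_inDual (m br m' br') (f g : FreeMod k (Module.Dual k A)) :
    gdBracket (doubleMul m m') (doubleBr (A := A) br br') (inDual k A f) (inDual k A g)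
      = mapLam ((inDual k A).restrictScalars k) (gdBracket m' br' f g) := by
  refine FreeMod.ext_ev_evalAt fun l x : k => ?_
  simp [ev_mapLam, evalAt_ev_gdBracket, doubleLoop_right]

theorem isInvariantConformalForm_double (h : ∀ a, br a a = 0) (h' : ∀ f, br' f f = 0) :
    IsInvariantConformalForm (gdBracket (doubleMul m m') (doubleBr br br'))
      (confForm (doubleForm k A)) where
  del_left u v := Polynomial.funext fun l => by simp [eval_confForm]
  del_right u v := Polynomial.funext fun l => by simp [eval_confForm]
  symm u v l := by rw [eval_confForm, eval_confForm, neg_neg, doubleForm_symm]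
  invariant u v w l n := by
    rw [eval_confForm, eval_confForm, evalAt_subst_sub_del, evalAt_ev_gdBracket,
      evalAt_ev_gdBracket,
      loopBr_invariant (r := l) doubleForm_symm (doubleMul_invariant m m')
        (doubleBr_invariant h h') (by ring), sub_add_cancel, neg_sub, ← sub_eq_add_neg]
  nondegenerate phi := by
    -- `θ` inverts the isomorphism of `A ⊕ A*` with its dual given by the form.
    let θ : Module.Dual k (A × Module.Dual k A) →ₗ[k] A × Module.Dual k A :=
      ((Module.evalEquiv k A).symm.toLinearMap ∘ₗ
        (LinearMap.inr k A (Module.Dual k A)).dualMap).prod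
        (LinearMap.inl k A (Module.Dual k A)).dualMap
    have hθ : ∀ φ v, doubleForm k A (θ φ) v = φ v := by
      intro φ v
      have h1 : v.2 (θ φ).1 = φ (0, v.2) := by
        have : v.2 (θ φ).1 = Module.evalEquiv k A ((Module.evalEquiv k A).symm
          ((LinearMap.inr k A (Module.Dual k A)).dualMap φ)) v.2 := rfl
        rw [this, LinearEquiv.apply_symm_apply]
        rfl
      have h2 : (θ φ).2 v.1 = φ (v.1, 0) := rfl
      rw [doubleForm_apply, h1, h2, ← map_add]
      simp
    obtain ⟨G, rfl⟩ := (dualIso k (A × Module.Dual k A)).surjective phi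
    have hG : ∀ u, confForm (doubleForm k A) (θ.baseChange k[X] G) u
        = (dualIso k (A × Module.Dual k A) G).app u := fun u => Polynomial.funext fun l => by
      rw [eval_confForm, evalAt_baseChange, hθ, eval_dualIso]
    refine ⟨θ.baseChange k[X] G, hG, fun v hv => sub_eq_zero.1 (eq_zero_of_confForm _ fun u => ?_)⟩
    rw [map_sub, LinearMap.sub_apply, hv, hG, sub_self]

/-- The Lie conformal algebra of a Gel'fand–Dorfman double is a conformal Manin triple. -/
theorem isConformalManinTriple_double (hA : IsGDAlgebra m br) (hA' : IsGDAlgebra m' br')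
    (h : IsGDAlgebra (doubleMul m m') (doubleBr br br')) :
    IsConformalManinTriple (gdBracket (doubleMul m m') (doubleBr br br'))
      (confForm (doubleForm k A)) (gdBracket m br) (inA k A) (gdBracket m' br') (inDual k A) where
  finite := inferInstance
  finite_left := inferInstance
  finite_right := inferInstance
  total := isLieConformal_gdBracket_iff.2 h
  left := isLieConformal_gdBracket_iff.2 hA
  right := isLieConformal_gdBracket_iff.2 hA'
  hom_left := gdBracket_double_inA m br m' br'
  hom_right := gdBracket_double_inDual m br m' br'
  directSum := inA_coprod_inDual_bijective
  form := isInvariantConformalForm_double hA.lie.alternating hA'.lie.alternating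
  isotropic_left a b := Polynomial.funext fun l => by simp [eval_confForm]
  isotropic_right f g := Polynomial.funext fun l => by simp [eval_confForm]

/-- The bracket of a conformal Manin triple on `k[∂](A ⊕ A*)` is determined by the brackets of the
two subalgebras. -/
theorem IsConformalManinTriple.eq_double
    {b : FreeMod k (A × Module.Dual k A) →ₗ[k] FreeMod k (A × Module.Dual k A) →ₗ[k]
      LamPoly (FreeMod k (A × Module.Dual k A))}
    (hA : ∀ a, br a a = 0) (hA' : ∀ f, br' f f = 0)
    (h : IsConformalManinTriple b (confForm (doubleForm k A)) (gdBracket m br) (inA k A)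
      (gdBracket m' br') (inDual k A)) :
    b = gdBracket (doubleMul m m') (doubleBr br br') := by
  set N := b - gdBracket (doubleMul m m') (doubleBr br br') with hN
  have cyc : ∀ u v w (l n : k), (confForm (doubleForm k A) (ev n (N u v)) w).eval l
      = (confForm (doubleForm k A) (ev (l - n) (N v w)) u).eval (-n) := by
    intro u v w l n
    simp only [hN, LinearMap.sub_apply, map_sub, eval_sub]
    rw [h.form.cyclic, (isInvariantConformalForm_double hA hA').cyclic]
  have zA : ∀ u v, N (inA k A u) (inA k A v) = 0 := fun u v => by
    rw [hN, LinearMap.sub_apply, LinearMap.sub_apply, h.hom_left, gdBracket_double_inA, sub_self]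
  have zF : ∀ u v, N (inDual k A u) (inDual k A v) = 0 := fun u v => by
    rw [hN, LinearMap.sub_apply, LinearMap.sub_apply, h.hom_right, gdBracket_double_inDual,
      sub_self]
  have key : ∀ w u v (l n : k), (confForm (doubleForm k A) (ev n (N u v)) w).eval l = 0 := by
    intro w u v l n
    induction u using freeMod_prod_induction with
    | hadd u u' hu hu' =>
      simp only [map_add, LinearMap.add_apply, eval_add, hu, hu', add_zero]
    | hA a =>
      induction v using freeMod_prod_induction with
      | hadd v v' hv hv' => simp only [map_add, LinearMap.add_apply, eval_add, hv, hv', add_zero]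
      | hA b => rw [zA]; simp
      | hF f =>
        induction w using freeMod_prod_induction with
        | hadd v v' hv hv' => simp only [map_add, eval_add, hv, hv', add_zero]
        | hA b => rw [cyc, cyc, zA]; simp
        | hF g => rw [cyc, zF]; simp
    | hF f =>
      induction v using freeMod_prod_induction with
      | hadd v v' hv hv' => simp only [map_add, LinearMap.add_apply, eval_add, hv, hv', add_zero]
      | hF b => rw [zF]; simp
      | hA a =>
        induction w using freeMod_prod_induction with
        | hadd v v' hv hv' => simp only [map_add, eval_add, hv, hv', add_zero]
        | hA b => rw [cyc, zA]; simp
        | hF g => rw [cyc, cyc, zF]; simp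
  rw [← sub_eq_zero, ← hN]
  refine LinearMap.ext fun u => LinearMap.ext fun v => LamPoly.ext_ev fun n : k => ?_
  rw [LinearMap.zero_apply, LinearMap.zero_apply, map_zero]
  exact eq_zero_of_confForm _ fun w => Polynomial.funext fun l => by rw [key, eval_zero]

theorem IsConformalManinTriple.isGDAlgebra_double
    {b : FreeMod k (A × Module.Dual k A) →ₗ[k] FreeMod k (A × Module.Dual k A) →ₗ[k]
      LamPoly (FreeMod k (A × Module.Dual k A))}
    (hA : ∀ a, br a a = 0) (hA' : ∀ f, br' f f = 0)
    (h : IsConformalManinTriple b (confForm (doubleForm k A)) (gdBracket m br) (inA k A)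
      (gdBracket m' br') (inDual k A)) :
    IsGDAlgebra (doubleMul m m') (doubleBr br br') := by
  rw [← isLieConformal_gdBracket_iff, ← h.eq_double hA hA']
  exact h.total

theorem isBialgebraOfManinTriple_iff {D d : A →ₗ[k] A ⊗[k] A}
    {b : FreeMod k A →ₗ[k] FreeMod k A →ₗ[k] LamPoly (FreeMod k A)}
    {δ : FreeMod k A →ₗ[k] FreeMod k A ⊗[k] FreeMod k A} :
    IsBialgebraOfManinTriple (gdBracket (doubleMul m (dualOp D)) (doubleBr br (dualOp d)))
      (confForm (doubleForm k A)) (inA k A) (inDual k A) b δ ↔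
    b = gdBracket m br ∧ δ = cobracket D d := by
  have hp : ∀ (f g : FreeMod k (Module.Dual k A)) (w : FreeMod k A ⊗[k] FreeMod k A) (l n : k),
      LinearMap.mul' k k (TensorProduct.map
        (Polynomial.leval n ∘ₗ confForm (doubleForm k A) (inDual k A f) ∘ₗ
          (inA k A).restrictScalars k)
        (Polynomial.leval (l - n) ∘ₗ confForm (doubleForm k A) (inDual k A g) ∘ₗ
          (inA k A).restrictScalars k) w)
      = pair₂ (evalAt (-n) f) (evalAt (n - l) g) (evalAt₂ n (l - n) w) := by
    intro f g w l n
    induction w using TensorProduct.induction_on with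
    | zero => simp
    | add u v hu hv => simp only [map_add, hu, hv]
    | tmul u v => simp [Polynomial.leval_apply, eval_confForm]
  have hl : ∀ (f g : FreeMod k (Module.Dual k A)) (a : FreeMod k A) (l n : k),
      (confForm (doubleForm k A) (ev n (gdBracket (doubleMul m (dualOp D))
        (doubleBr br (dualOp d)) (inDual k A f) (inDual k A g))) (inA k A a)).eval l
      = evalAt (-l) (ev n (gdBracket (dualOp D) (dualOp d) f g)) (evalAt l a) := by
    intro f g a l n
    rw [gdBracket_double_inDual, ev_mapLam, eval_confForm]
    simp
  have hi : ∀ w w' : LamPoly (FreeMod k A), mapLam ((inA k A).restrictScalars k) w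
      = mapLam ((inA k A).restrictScalars k) w' → w = w' := by
    intro w w' h
    refine FreeMod.ext_ev_evalAt fun l x : k => ?_
    have := congrArg (fun z => evalAt x (ev l z)) h
    simpa [ev_mapLam] using this
  rw [eq_cobracket_iff]
  constructor
  · intro h
    refine ⟨LinearMap.ext₂ fun a b => hi _ _ ?_, fun f g a l n => ?_⟩
    · rw [h.bracket, gdBracket_double_inA]
    · rw [← hl, h.cobracket, hp]
  · rintro ⟨rfl, h⟩
    refine ⟨fun a b => (gdBracket_double_inA ..).symm, fun f g a l n => ?_⟩
    rw [hl, h, hp]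

end ConformalDouble

/-! ### Transport of Lie conformal algebras -/

section Transport

variable {k : Type*} [Field k]
variable {P : Type*} [AddCommGroup P] [Module k P] [Module k[X] P] [IsScalarTower k k[X] P]
variable {Q : Type*} [AddCommGroup Q] [Module k Q] [Module k[X] Q] [IsScalarTower k k[X] Q]
variable {br : P →ₗ[k] P →ₗ[k] LamPoly P} {br' : Q →ₗ[k] Q →ₗ[k] LamPoly Q}

theorem map_del (e : P →ₗ[k[X]] Q) (u : P) : e (del k P u) = del k Q (e u) := by simp [del]

theorem IsLieConformal.of_injective (e : P →ₗ[k[X]] Q) (he : Function.Injective e)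
    (h : ∀ u v, mapLam (e.restrictScalars k) (br u v) = br' (e u) (e v))
    (hQ : IsLieConformal br') : IsLieConformal br := by
  have hev : ∀ u v (l : k), e (ev l (br u v)) = ev l (br' (e u) (e v)) := fun u v l => by
    rw [← h, ev_mapLam]; rfl
  have hs : ∀ u v (l : k), e (subst (-(l • 1) - del k P) (br u v))
      = subst (-(l • 1) - del k Q) (br' (e u) (e v)) := fun u v l => by
    rw [← h, subst_mapLam (f := e.restrictScalars k) (T := -(l • 1) - del k P)]
    · rfl
    · intro w
      simp [map_del]
  have hsm : ∀ (l : k) (u : P), e (l • u) = l • e u := (e.restrictScalars k).map_smul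
  refine ⟨⟨fun a v l => he ?_, fun a v l => he ?_⟩, fun a b l => he ?_, fun a b c l n => he ?_⟩
  · rw [hev, map_del, hQ.sesquilinear.map_del, map_neg, hsm, hev]
  · rw [hev, map_del, hQ.sesquilinear.conformal, map_add, hsm, map_del, hev]
  · rw [hev, hQ.skew, map_neg, hs]
  · rw [hev, hev, hQ.jacobi, map_add, hev, hev, hev, hev]

theorem isLieConformal_iff_of_bijective (e : P →ₗ[k[X]] Q) (he : Function.Bijective e)
    (h : ∀ u v, mapLam (e.restrictScalars k) (br u v) = br' (e u) (e v)) :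
    IsLieConformal br ↔ IsLieConformal br' := by
  refine ⟨fun hP => ?_, IsLieConformal.of_injective e he.1 h⟩
  let i := LinearEquiv.ofBijective e he
  refine IsLieConformal.of_injective i.symm.toLinearMap i.symm.injective (fun u v => ?_) hP
  obtain ⟨u, rfl⟩ := i.surjective u
  obtain ⟨v, rfl⟩ := i.surjective v
  have h1 : br' (i u) (i v) = mapLam (e.restrictScalars k) (br u v) := (h u v).symm
  rw [h1]
  ext n
  have h2 : ∀ w, i.symm (e w) = w := i.symm_apply_apply
  simp [mapLam, h2]

end Transport

/-! ### Matched pairs of Lie conformal algebras -/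

section Matched

variable {k : Type*} [Field k] {A : Type*} [AddCommGroup A] [Module k A]

theorem ext_dual {a b : A} (h : ∀ f : Module.Dual k A, f a = f b) : a = b := by
  rw [← sub_eq_zero, ← Module.forall_dual_apply_eq_zero_iff k]
  exact fun f => by rw [map_sub, h, sub_self]

theorem bidual_at (a : FreeMod k A) (n : k) (ψ : ConfDual k (FreeMod k A)) :
    (bidual k (FreeMod k A) a).at n ψ = ψ.at (-n) a :=
  eval_twist n (ψ.app a)

variable [FiniteDimensional k A]

/-- The value in `A*`, at `∂ = x`, of an element of the conformal dual `(k[∂]A)^{*c} = k[∂]A*`. -/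
noncomputable def dualAt (x : k) : ConfDual k (FreeMod k A) →ₗ[k] Module.Dual k A :=
  evalAt x ∘ₗ (dualIso k A).symm.toLinearMap.restrictScalars k

theorem dualAt_apply (x : k) (φ : ConfDual k (FreeMod k A)) :
    dualAt x φ = evalAt x ((dualIso k A).symm φ) := rfl

@[simp] theorem dualAt_dualIso (x : k) (G : FreeMod k (Module.Dual k A)) :
    dualAt x (dualIso k A G) = evalAt x G := by simp [dualAt_apply]

theorem at_eq_dualAt (φ : ConfDual k (FreeMod k A)) (n : k) (u : FreeMod k A) :
    φ.at n u = dualAt (-n) φ (evalAt n u) := by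
  obtain ⟨G, rfl⟩ := (dualIso k A).surjective φ
  rw [dualAt_dualIso, ← eval_dualIso]
  rfl

@[simp] theorem dualAt_del (x : k) (φ : ConfDual k (FreeMod k A)) :
    dualAt x (del k (ConfDual k (FreeMod k A)) φ) = x • dualAt x φ := by
  obtain ⟨G, rfl⟩ := (dualIso k A).surjective φ
  have := map_del (dualIso k A).toLinearMap G
  rw [LinearEquiv.coe_coe] at this
  rw [← this, dualAt_dualIso, dualAt_dualIso, evalAt_del]

@[simp] theorem evalAt_splitIso_fst (x : k) (u : FreeMod k (A × Module.Dual k A)) :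
    evalAt x (splitIso k A u).1 = (evalAt x u).1 :=
  evalAt_baseChange (LinearMap.fst k A (Module.Dual k A)) x u

@[simp] theorem dualAt_splitIso_snd (x : k) (u : FreeMod k (A × Module.Dual k A)) :
    dualAt x (splitIso k A u).2 = (evalAt x u).2 :=
  (dualAt_dualIso x _).trans (evalAt_baseChange (LinearMap.snd k A (Module.Dual k A)) x u)

theorem ext_dualAt [CharZero k] {φ ψ : ConfDual k (FreeMod k A)}
    (h : ∀ x : k, dualAt x φ = dualAt x ψ) :
    φ = ψ :=
  (dualIso k A).symm.injective (FreeMod.ext_evalAt h)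

theorem dualAt_subst_neg_sub_del (c x : k) (w : LamPoly (ConfDual k (FreeMod k A))) :
    dualAt x (subst (-(c • 1) - del k (ConfDual k (FreeMod k A))) w)
      = dualAt x (ev (-c - x) w) :=
  map_subst_of_intertwine (fun v => by simp [sub_smul]) w

variable (m br : A →ₗ[k] A →ₗ[k] A)
  (m' br' : Module.Dual k A →ₗ[k] Module.Dual k A →ₗ[k] Module.Dual k A)

theorem dualAt_ev_dualBracket (l x : k) (f g : ConfDual k (FreeMod k A)) :
    dualAt x (ev l (dualBracket m' br' f g))
      = loopBr m' br' (-l) (l + x) (dualAt (-l) f) (dualAt (l + x) g) := by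
  have h : dualBracket m' br' f g = mapLam ((dualIso k A).toLinearMap.restrictScalars k)
      (gdBracket m' br' ((dualIso k A).symm f) ((dualIso k A).symm g)) := rfl
  rw [h, ev_mapLam, LinearMap.restrictScalars_apply, LinearEquiv.coe_coe, dualAt_dualIso,
    evalAt_ev_gdBracket, dualAt_apply, dualAt_apply]

theorem isLieConformal_dualBracket [CharZero k]
    {m' br' : Module.Dual k A →ₗ[k] Module.Dual k A →ₗ[k] Module.Dual k A}
    (h : IsGDAlgebra m' br') :
    IsLieConformal (dualBracket (A := A) m' br') := by
  refine (isLieConformal_iff_of_bijective (dualIso k A).toLinearMap (dualIso k A).bijective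
    fun u v => LamPoly.ext_ev fun l : k => ext_dualAt fun x : k => ?_).1
    (isLieConformal_gdBracket_iff.2 h)
  rw [dualAt_ev_dualBracket, ev_mapLam]
  simp [evalAt_ev_gdBracket]

variable {m br m' br'}
  {ρ : FreeMod k A →ₗ[k] ConfDual k (FreeMod k A) →ₗ[k] LamPoly (ConfDual k (FreeMod k A))}
  {σ : ConfDual k (FreeMod k A) →ₗ[k] FreeMod k A →ₗ[k] LamPoly (FreeMod k A)}

/-- The coadjoint action of `k[∂]A`, evaluated. -/
theorem isDualAction_id_iff : IsDualAction (gdBracket m br) LinearMap.id ρ ↔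
    ∀ a φ (l x : k) b, dualAt x (ev l (ρ a φ)) b
      = - dualAt (l + x) φ (loopBr m br (-l) (-x) (evalAt (-l) a) b) := by
  constructor
  · intro h a φ l x b
    have := h a φ (incl k A b) l (-x)
    simp only [LinearMap.id_apply, at_eq_dualAt, evalAt_incl, evalAt_ev_gdBracket, neg_neg] at this
    rw [this]
    ring_nf
  · intro h a φ u l n
    simp only [LinearMap.id_apply, at_eq_dualAt, evalAt_ev_gdBracket]
    rw [h]
    ring_nf

/-- The coadjoint action of `k[∂]A*`, evaluated. -/
theorem isDualAction_bidual_iff :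
    IsDualAction (dualBracket m' br') (bidual k (FreeMod k A)) σ ↔
    ∀ φ a (l x : k) (g : Module.Dual k A), g (evalAt x (ev l (σ φ a)))
      = - loopBr m' br' (-l) (-x) (dualAt (-l) φ) g (evalAt (l + x) a) := by
  constructor
  · intro h φ a l x g
    have := h φ a (dualIso k A (incl k _ g)) l (-x)
    simp only [bidual_at, at_eq_dualAt, neg_neg, dualAt_dualIso, evalAt_incl,
      dualAt_ev_dualBracket] at this
    rw [this]
    ring_nf
  · intro h φ a ψ l n
    simp only [bidual_at, at_eq_dualAt, neg_neg, dualAt_ev_dualBracket]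
    rw [h]
    ring_nf

variable [CharZero k]

theorem IsDualAction.isConformalAction_left (h : IsDualAction (gdBracket m br) LinearMap.id ρ) :
    IsConformalAction ρ := by
  rw [isDualAction_id_iff] at h
  refine ⟨fun a φ l => ext_dualAt fun x : k => LinearMap.ext fun b => ?_,
    fun a φ l => ext_dualAt fun x : k => LinearMap.ext fun b => ?_⟩
  · simp [h]
  · simp [h]
    ring

theorem IsDualAction.isConformalAction_right
    (h : IsDualAction (dualBracket m' br') (bidual k (FreeMod k A)) σ) :
    IsConformalAction σ := by
  rw [isDualAction_bidual_iff] at h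
  refine ⟨fun a φ l => FreeMod.ext_evalAt fun x : k => ext_dual (k := k) fun b => ?_,
    fun a φ l => FreeMod.ext_evalAt fun x : k => ext_dual (k := k) fun b => ?_⟩
  · simp [h]
  · simp [h]
    ring

theorem splitIso_bijective : Function.Bijective (splitIso k A) := by
  constructor
  · intro u v h
    refine FreeMod.ext_evalAt fun x : k => Prod.ext ?_ ?_
    · rw [← evalAt_splitIso_fst, h, evalAt_splitIso_fst]
    · rw [← dualAt_splitIso_snd, h, dualAt_splitIso_snd]
  · rintro ⟨a, φ⟩
    refine ⟨inA k A a + inDual k A ((dualIso k A).symm φ), Prod.ext ?_ ?_⟩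
    · refine FreeMod.ext_evalAt fun x : k => ?_
      simp
    · refine ext_dualAt fun x : k => ?_
      rw [dualAt_splitIso_snd]
      simp [dualAt_apply]

/-- A `λ`-bracket on `k[∂]A ⊕ (k[∂]A)^{*c}` is the matched bracket of the coadjoint actions if and
only if it corresponds to the `λ`-bracket of the double. -/
theorem isMatchedBracket_iff
    (hρ : IsDualAction (gdBracket m br) LinearMap.id ρ)
    (hσ : IsDualAction (dualBracket m' br') (bidual k (FreeMod k A)) σ)
    {b : (FreeMod k A × ConfDual k (FreeMod k A)) →ₗ[k]
      (FreeMod k A × ConfDual k (FreeMod k A)) →ₗ[k]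
        LamPoly (FreeMod k A × ConfDual k (FreeMod k A))} :
    IsMatchedBracket (gdBracket m br) (dualBracket m' br') ρ σ b ↔
    ∀ u v, mapLam ((splitIso k A).restrictScalars k)
        (gdBracket (doubleMul m m') (doubleBr br br') u v)
      = b (splitIso k A u) (splitIso k A v) := by
  rw [isDualAction_id_iff] at hρ
  rw [isDualAction_bidual_iff] at hσ
  have key : ∀ u v (l : k), splitIso k A
      (ev l (gdBracket (doubleMul m m') (doubleBr br br') u v))
      = (ev l (gdBracket m br (splitIso k A u).1 (splitIso k A v).1)
          + ev l (σ (splitIso k A u).2 (splitIso k A v).1)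
          - subst (-(l • 1) - del k _) (σ (splitIso k A v).2 (splitIso k A u).1),
        ev l (dualBracket m' br' (splitIso k A u).2 (splitIso k A v).2)
          + ev l (ρ (splitIso k A u).1 (splitIso k A v).2)
          - subst (-(l • 1) - del k _) (ρ (splitIso k A v).1 (splitIso k A u).2)) := by
    intro u v l
    refine Prod.ext (FreeMod.ext_evalAt fun x : k => ext_dual (k := k) fun g => ?_)
      (ext_dualAt fun x : k => LinearMap.ext fun c => ?_)
    · have e1 : -(-l - x) = l + x := by ring
      have e2 : -l - x + x = -l := by ring
      have e3 : -(-l) - (l + x) = -x := by ring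
      simp only [map_add, map_sub, evalAt_subst_neg_sub_del, evalAt_splitIso_fst,
        evalAt_ev_gdBracket, hσ, dualAt_splitIso_snd, e1, e2]
      rw [apply_doubleLoop_fst, e3]
      ring
    · have e1 : -(-l - x) = l + x := by ring
      have e2 : -l - x + x = -l := by ring
      have e3 : -(-l) - (l + x) = -x := by ring
      simp only [map_add, map_sub, dualAt_subst_neg_sub_del, evalAt_splitIso_fst,
        evalAt_ev_gdBracket, hρ, dualAt_splitIso_snd, dualAt_ev_dualBracket,
        LinearMap.add_apply, LinearMap.sub_apply, e1, e2]
      rw [doubleLoop_snd_apply, e3]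
      ring
  constructor
  · intro h u v
    refine LamPoly.ext_ev fun l : k => ?_
    rw [ev_mapLam, LinearMap.restrictScalars_apply, key]
    exact (h _ _ _ _ l).symm
  · intro h a c φ ψ l
    obtain ⟨u, hu⟩ := splitIso_bijective (k := k) (A := A) |>.2 (a, φ)
    obtain ⟨v, hv⟩ := splitIso_bijective (k := k) (A := A) |>.2 (c, ψ)
    rw [← hu, ← hv, ← h, ev_mapLam, LinearMap.restrictScalars_apply, key, hu, hv]

/-- The coadjoint actions and their matched bracket exist: they are components of the `λ`-bracket
of the double. -/
theorem exists_isMatchedBracket (m br m' br') : ∃ ρ σ b,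
    IsDualAction (gdBracket m br) LinearMap.id ρ ∧
    IsDualAction (dualBracket m' br') (bidual k (FreeMod k A)) σ ∧
    IsMatchedBracket (gdBracket m br) (dualBracket m' br') ρ σ b := by
  let e := LinearEquiv.ofBijective (splitIso k A) splitIso_bijective
  let s : FreeMod k A × ConfDual k (FreeMod k A) →ₗ[k] FreeMod k (A × Module.Dual k A) :=
    e.symm.toLinearMap.restrictScalars k
  let b : (FreeMod k A × ConfDual k (FreeMod k A)) →ₗ[k]
      (FreeMod k A × ConfDual k (FreeMod k A)) →ₗ[k]
        LamPoly (FreeMod k A × ConfDual k (FreeMod k A)) :=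
    ((gdBracket (doubleMul m m') (doubleBr br br')).compl₁₂ s s).compr₂
      (mapLam ((splitIso k A).restrictScalars k))
  have hb : ∀ U V (l : k), ev l (b U V)
      = splitIso k A (ev l (gdBracket (doubleMul m m') (doubleBr br br') (s U) (s V))) :=
    fun U V l => ev_mapLam _ _ _
  have hs1 : ∀ U, splitIso k A (s U) = U := fun U => e.apply_symm_apply U
  have hs2 : ∀ u, s (splitIso k A u) = u := fun u => e.symm_apply_apply u
  have v1 : ∀ (x : k) U, (evalAt x (s U)).1 = evalAt x U.1 := fun x U => by
    rw [← evalAt_splitIso_fst, hs1]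
  have v2 : ∀ (x : k) U, (evalAt x (s U)).2 = dualAt x U.2 := fun x U => by
    rw [← dualAt_splitIso_snd, hs1]
  let ρ : FreeMod k A →ₗ[k] ConfDual k (FreeMod k A) →ₗ[k] LamPoly (ConfDual k (FreeMod k A)) :=
    (b.compl₁₂ (LinearMap.inl k _ _) (LinearMap.inr k _ _)).compr₂ (mapLam (LinearMap.snd k _ _))
  let σ : ConfDual k (FreeMod k A) →ₗ[k] FreeMod k A →ₗ[k] LamPoly (FreeMod k A) :=
    (b.compl₁₂ (LinearMap.inr k _ _) (LinearMap.inl k _ _)).compr₂ (mapLam (LinearMap.fst k _ _))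
  have hρ' : ∀ a φ (l : k), ev l (ρ a φ) = (ev l (b (a, 0) (0, φ))).2 :=
    fun a φ l => ev_mapLam _ _ _
  have hσ' : ∀ φ a (l : k), ev l (σ φ a) = (ev l (b (0, φ) (a, 0))).1 :=
    fun a φ l => ev_mapLam _ _ _
  have e3 : ∀ l x : k, -(-l) - (l + x) = -x := fun l x => by ring
  have hρ : IsDualAction (gdBracket m br) LinearMap.id ρ := by
    refine isDualAction_id_iff.2 fun a φ l x c => ?_
    rw [hρ', hb, dualAt_splitIso_snd, evalAt_ev_gdBracket, doubleLoop_snd_apply, e3]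
    simp [v1, v2]
  have hσ : IsDualAction (dualBracket m' br') (bidual k (FreeMod k A)) σ := by
    refine isDualAction_bidual_iff.2 fun φ a l x g => ?_
    rw [hσ', hb, evalAt_splitIso_fst, evalAt_ev_gdBracket, apply_doubleLoop_fst, e3]
    simp [v1, v2]
  refine ⟨ρ, σ, b, hρ, hσ, (isMatchedBracket_iff hρ hσ).2 fun u v => ?_⟩
  refine LamPoly.ext_ev fun l : k => ?_
  rw [ev_mapLam, hb, hs2, hs2]
  rfl

/-- A matched bracket of the coadjoint actions is a Lie conformal bracket if and only if the double
is a Gel'fand–Dorfman algebra. -/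
theorem isLieConformal_matched_iff
    (hρ : IsDualAction (gdBracket m br) LinearMap.id ρ)
    (hσ : IsDualAction (dualBracket m' br') (bidual k (FreeMod k A)) σ)
    {b : (FreeMod k A × ConfDual k (FreeMod k A)) →ₗ[k]
      (FreeMod k A × ConfDual k (FreeMod k A)) →ₗ[k]
        LamPoly (FreeMod k A × ConfDual k (FreeMod k A))}
    (hb : IsMatchedBracket (gdBracket m br) (dualBracket m' br') ρ σ b) :
    IsLieConformal b ↔ IsGDAlgebra (doubleMul m m') (doubleBr br br') := by
  rw [← isLieConformal_gdBracket_iff]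
  exact (isLieConformal_iff_of_bijective (splitIso k A) splitIso_bijective
    ((isMatchedBracket_iff hρ hσ).1 hb)).symm

theorem isMatchedPairLCA_of_double
    (hA : IsGDAlgebra m br) (hA' : IsGDAlgebra m' br')
    (hρ : IsDualAction (gdBracket m br) LinearMap.id ρ)
    (hσ : IsDualAction (dualBracket m' br') (bidual k (FreeMod k A)) σ)
    {b : (FreeMod k A × ConfDual k (FreeMod k A)) →ₗ[k]
      (FreeMod k A × ConfDual k (FreeMod k A)) →ₗ[k]
        LamPoly (FreeMod k A × ConfDual k (FreeMod k A))}
    (hb : IsMatchedBracket (gdBracket m br) (dualBracket m' br') ρ σ b)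
    (h : IsGDAlgebra (doubleMul m m') (doubleBr br br')) :
    IsMatchedPairLCA (gdBracket m br) (dualBracket m' br') ρ σ where
  left := isLieConformal_gdBracket_iff.2 hA
  right := isLieConformal_dualBracket hA'
  action_left := hρ.isConformalAction_left
  action_right := hσ.isConformalAction_right
  total := ⟨b, hb, (isLieConformal_matched_iff hρ hσ hb).2 h⟩

theorem isBialgebraOfMatchedPair_iff {D d : A →ₗ[k] A ⊗[k] A}
    {b : (FreeMod k A × ConfDual k (FreeMod k A)) →ₗ[k]
      (FreeMod k A × ConfDual k (FreeMod k A)) →ₗ[k]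
        LamPoly (FreeMod k A × ConfDual k (FreeMod k A))}
    (hb : IsMatchedBracket (gdBracket m br) (dualBracket (dualOp D) (dualOp d)) ρ σ b)
    {b' : FreeMod k A →ₗ[k] FreeMod k A →ₗ[k] LamPoly (FreeMod k A)}
    {δ : FreeMod k A →ₗ[k] FreeMod k A ⊗[k] FreeMod k A} :
    IsBialgebraOfMatchedPair b b' δ ↔ b' = gdBracket m br ∧ δ = cobracket D d := by
  have hp : ∀ (f g : ConfDual k (FreeMod k A)) (w : FreeMod k A ⊗[k] FreeMod k A) (l n : k),
      LinearMap.mul' k k (TensorProduct.map (f.at n) (g.at (l - n)) w)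
      = pair₂ (dualAt (-n) f) (dualAt (n - l) g) (evalAt₂ n (l - n) w) := by
    intro f g w l n
    induction w using TensorProduct.induction_on with
    | zero => simp
    | add u v hu hv => simp only [map_add, hu, hv]
    | tmul u v => simp [at_eq_dualAt]
  have hl : ∀ (f g : FreeMod k (Module.Dual k A)) (a : FreeMod k A) (l n : k),
      (ev n (b (0, dualIso k A f) (0, dualIso k A g))).2.at l a
      = evalAt (-l) (ev n (gdBracket (dualOp D) (dualOp d) f g)) (evalAt l a) := by
    intro f g a l n
    rw [hb, at_eq_dualAt]
    simp [dualAt_ev_dualBracket, evalAt_ev_gdBracket]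
  have hr : ∀ (u v : FreeMod k A) (l : k),
      ev l (b (u, 0) (v, 0)) = (ev l (gdBracket m br u v), 0) :=
    fun u v l => by rw [hb]; simp
  rw [eq_cobracket_iff]
  constructor
  · intro h
    refine ⟨LinearMap.ext₂ fun u v => LamPoly.ext_ev fun l : k => ?_, fun f g a l n => ?_⟩
    · have := congrArg (ev l) (h.bracket u v)
      rw [ev_mapLam, hr] at this
      exact congrArg Prod.fst this
    · rw [← hl, h.cobracket, hp, dualAt_dualIso, dualAt_dualIso]
  · rintro ⟨rfl, h⟩
    refine ⟨fun u v => LamPoly.ext_ev fun l : k => ?_, fun f g a l n => ?_⟩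
    · rw [ev_mapLam, hr]
      rfl
    · obtain ⟨f, rfl⟩ := (dualIso k A).surjective f
      obtain ⟨g, rfl⟩ := (dualIso k A).surjective g
      rw [hl, h, hp, dualAt_dualIso, dualAt_dualIso]

end Matched

end GDConformal

theorem proposition4p19 {k : Type*} [Field k] [CharZero k]
    {A : Type*} [AddCommGroup A] [Module k A] [FiniteDimensional k A]
    -- the operations `∘`, `[·,·]` and the cooperations `Δ`, `δ₀` of `A`
    (m br : A →ₗ[k] A →ₗ[k] A) (D d₀ : A →ₗ[k] A ⊗[k] A)
    (hA : IsGDAlgebra m br) (hD : IsGDCoalgebra D d₀) :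
    -- the six corners of the diagram are equivalent
    List.TFAE [
      IsGDBialgebra m br D d₀,
      ∃ M B, IsManinTripleGD M B m br (dualOp D) (dualOp d₀),
      IsMatchedPairGD m br (dualOp D) (dualOp d₀)
        (dualRep (starOp m)) (-dualRep m.flip) (dualRep br)
        (dualRep' (starOp (dualOp D))) (-dualRep' (dualOp D).flip) (dualRep' (dualOp d₀)),
      IsLieConformalBialgebra (gdBracket m br) (cobracket D d₀),
      ∃ b, IsConformalManinTriple b (confForm (doubleForm k A))
        (gdBracket m br) (inA k A) (gdBracket (dualOp D) (dualOp d₀)) (inDual k A),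
      ∃ ρ σ,
        IsDualAction (gdBracket m br) LinearMap.id ρ ∧
        IsDualAction (dualBracket (dualOp D) (dualOp d₀)) (bidual k (FreeMod k A)) σ ∧
        IsMatchedPairLCA (gdBracket m br) (dualBracket (dualOp D) (dualOp d₀)) ρ σ] ∧
    -- for a GD bialgebra, the objects at the corners correspond to each other
    (IsGDBialgebra m br D d₀ →
      -- the Lie conformal bialgebra obtained from the conformal Manin triple
      (IsManinTripleGD (doubleMul m (dualOp D)) (doubleBr br (dualOp d₀))
          m br (dualOp D) (dualOp d₀) ∧
        IsConformalManinTriple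
          (gdBracket (doubleMul m (dualOp D)) (doubleBr br (dualOp d₀)))
          (confForm (doubleForm k A))
          (gdBracket m br) (inA k A) (gdBracket (dualOp D) (dualOp d₀)) (inDual k A) ∧
        ∀ b' δ', IsBialgebraOfManinTriple
            (gdBracket (doubleMul m (dualOp D)) (doubleBr br (dualOp d₀)))
            (confForm (doubleForm k A)) (inA k A) (inDual k A) b' δ' ↔
          b' = gdBracket m br ∧ δ' = cobracket D d₀) ∧
      -- the Lie conformal bialgebra obtained from the matched pair
      (∃ ρ σ b,
        IsDualAction (gdBracket m br) LinearMap.id ρ ∧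
        IsDualAction (dualBracket (dualOp D) (dualOp d₀)) (bidual k (FreeMod k A)) σ ∧
        IsMatchedPairLCA (gdBracket m br) (dualBracket (dualOp D) (dualOp d₀)) ρ σ ∧
        IsMatchedBracket (gdBracket m br) (dualBracket (dualOp D) (dualOp d₀)) ρ σ b ∧
        (∀ b' δ', IsBialgebraOfMatchedPair b b' δ' ↔
          b' = gdBracket m br ∧ δ' = cobracket D d₀) ∧
        -- the Lie conformal algebras of the matched pair and of the Manin triple agree
        Function.Bijective (splitIso k A) ∧
        (∀ u v, mapLam ((splitIso k A).restrictScalars k)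
            (gdBracket (doubleMul m (dualOp D)) (doubleBr br (dualOp d₀)) u v)
          = b (splitIso k A u) (splitIso k A v)) ∧
        ∀ u v (l : k), (confForm (doubleForm k A) u v).eval l
          = (splitIso k A u).2.at l (splitIso k A v).1
            + (splitIso k A v).2.at (-l) (splitIso k A u).1)) := by
  have hA' := hD.dual
  have h0 := hA.lie.alternating
  have h0' := hA'.lie.alternating
  have hub : IsGDBialgebra m br D d₀ ↔
      IsGDAlgebra (doubleMul m (dualOp D)) (doubleBr br (dualOp d₀)) :=
    (isGDBialgebra_iff_loopCocycle hA hD).trans (isGDAlgebra_double_iff_loopCocycle hA hD).symm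
  obtain ⟨ρ, σ, b, hρ, hσ, hb⟩ := exists_isMatchedBracket m br (dualOp D) (dualOp d₀)
  constructor
  · tfae_have 1 → 2 := fun h => ⟨_, _, isManinTripleGD_double hA hA' (hub.1 h)⟩
    tfae_have 2 → 3 := by
      rintro ⟨M, B, h⟩
      obtain ⟨rfl, rfl⟩ := h.eq_double
      exact ⟨hA, hA', h.quadratic.algebra⟩
    tfae_have 3 → 1 := fun h => hub.2 h.total
    tfae_have 1 ↔ 4 := (isGDBialgebra_iff_loopCocycle hA hD).trans
      (isLieConformalBialgebra_iff_loopCocycle hA hD).symm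
    tfae_have 1 → 5 := fun h => ⟨_, isConformalManinTriple_double hA hA' (hub.1 h)⟩
    tfae_have 5 → 1 := fun ⟨_, h⟩ => hub.2 (h.isGDAlgebra_double h0 h0')
    tfae_have 1 → 6 := fun h =>
      ⟨ρ, σ, hρ, hσ, isMatchedPairLCA_of_double hA hA' hρ hσ hb (hub.1 h)⟩
    tfae_have 6 → 1 := by
      rintro ⟨ρ, σ, hρ, hσ, h⟩
      obtain ⟨b, hb, hL⟩ := h.total
      exact hub.2 ((isLieConformal_matched_iff hρ hσ hb).1 hL)
    tfae_finish
  · intro h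
    have hE := hub.1 h
    refine ⟨⟨isManinTripleGD_double hA hA' hE, isConformalManinTriple_double hA hA' hE,
      fun b' δ' => isBialgebraOfManinTriple_iff⟩, ρ, σ, b, hρ, hσ,
      isMatchedPairLCA_of_double hA hA' hρ hσ hb hE, hb,
      fun b' δ' => isBialgebraOfMatchedPair_iff hb, splitIso_bijective,
      (isMatchedBracket_iff hρ hσ).1 hb, fun u v l => ?_⟩
    rw [eval_confForm, at_eq_dualAt, at_eq_dualAt, neg_neg]
    simp
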